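/- **Setting.** A server delivers files of $F>0$ bits to $K$ users over a block-fading broadcast channel. The channel states $\mathbf h(0),\mathbf h(1),\dots$ are i.i.d. in a finite set $\mathcal H$ of vectors of positive gains, with probabilities $\phi_{\mathbf h}$. A slot has $T_{\rm slot}>0$ channel uses and the transmit power is $P>0$. Caches are filled by decentralized placement with normalized memory $m\in[0,1]$. Index sets $I,J$ below are nonempty subsets of $\{1,\dots,K\}$. For $I\subseteq J$ let $b_{J,I}=m^{|I|-1}(1-m)^{|J|-|I|+1}F$; this is the length of the codeword for $I$ when one file of each user in $J$ is combined. For $h_1\ge\dots\ge h_K$, the capacity region $\Gamma(\mathbf h)$ is the set of all $(R_J)_J\ge 0$ for which there are $p_1,\dots,p_K\ge 0$ with $\sum_k p_k\le P$ and $$\sum_{J\subseteq\{1,\dots,k\},\,k\in J}R_J\le\log_2\frac{1+h_k\sum_{j\le k}p_j}{1+h_k\sum_{j<k}p_j}\qquad(k=1,\dots,K).$$ For other gain vectors the users are first sorted by decreasing gain. A *scheme* chooses in each slot $t$, from the past, the current channel state and extra randomness (but not from future channel states), admissions $a_k(t)\in\mathbb N$, combinations $\sigma_J(t)\in\{0,\dots,\sigma_{\max}\}$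 with $\sigma_{\max}\ge1$, and rates $\mu(t)\in\Gamma(\mathbf h(t))$. It also chooses how the $\min\{S_k(t),\sum_{J\ni k}\sigma_J(t)\}$ files taken from user queue $k$ are distributed over the combinations for the sets $J\ni k$, with at most $\sigma_J(t)$ of them going to $J$. The queues start empty and evolve by $$S_k(t+1)=\Big[S_k(t)-\sum_{J\ni k}\sigma_J(t)\Big]^++a_k(t),\qquad Q_I(t+1)=\big[Q_I(t)-T_{\rm slot}\mu_I(t)\big]^++\sum_{J\supseteq I}b_{J,I}\sigma_J(t).$$ Codeword queues are first-in-first-out, and the codewords that enter a queue in the same slot are transmitted as one block. A file of user $k$ combined for $J$ is delivered once all codewords of that combination for the sets $I$ with $k\in I\subseteq J$ have been transmitted. Let $D_k(t)$ be the number of files delivered to $k$ before slot $t$. Codeword generation is *irrevocable* if, almost surely and for every $k$, only $o(t)$ of these $D_k(t)$ files belong to combinations some of whose codewords (for any $I\subseteq J$) have not been transmitted before slot $t$. All rate vectors are in $\mathbb R_{\ge0}^K$, and interior, boundary and closure are taken in this space. * $\Lambda^{CC}$ is the set of $\overline{\mathbf r}$ for which some irrevocable scheme has $\overline r_k=\liminf_{t\to\infty}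 D_k(t)/t$ almost surely for every $k$. * The *stability region* is the set of $\overline{\mathbf a}$ for which some scheme has $\lim_{T\to\infty}\frac1T\sum_{t<T}\mathbb E[a_k(t)]=\overline a_k$ for every $k$ and all queues strongly stable, that is, $\limsup_{T\to\infty}\frac1T\sum_{t<T}\mathbb E[S_k(t)]<\infty$ for every $k$ and $\limsup_{T\to\infty}\frac1T\sum_{t<T}\mathbb E[Q_I(t)]<\infty$ for every $I$. * $\Gamma^{CC}$ is the set of $\overline{\mathbf a}$ for which there are $\overline\mu\in\sum_{\mathbf h}\phi_{\mathbf h}\Gamma(\mathbf h)$ and $\overline\sigma_J\in[0,\sigma_{\max}]$ with $\sum_{J\ni k}\overline\sigma_J\ge\overline a_k$ for all $k$ and $T_{\rm slot}\overline\mu_I\ge\sum_{J\supseteq I}b_{J,I}\overline\sigma_J$ for all $I$. **Lemma 1.** Boundary points of $\Gamma^{CC}$ being disregarded, $\Lambda^{CC}$, the stability region and $\operatorname{Int}\Gamma^{CC}$ coincide: $$\Lambda^{CC}\setminus\partial\Gamma^{CC}=\operatorname{Int}\Gamma^{CC}=(\text{stability region})\setminus\partial\Gamma^{CC}.$$ If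 $T_{\rm slot}\sum_{\mathbf h}\phi_{\mathbf h}\log_2(1+Ph_k)\le(1-m)F\sigma_{\max}$ for every $k$, then the same holds for the set of delivery rate vectors of all schemes, irrevocable or not. **Corollary 1.** Let $g_k(x)=\frac{(d_k+x)^{1-\alpha_k}}{1-\alpha_k}$ if $\alpha_k\ne1$ and $g_k(x)=\log(1+x/d_k)$ if $\alpha_k=1$, where $\alpha_k\ge0$ and $d_k>0$. Then $\sup\sum_kg_k(\overline r_k)$ over $\overline{\mathbf r}\in\Lambda^{CC}$ equals $\sup\sum_kg_k(\overline a_k)$ over the admission rate vectors $\overline{\mathbf a}$ of schemes that keep the system stable. This value $v$ is finite, and the vectors in the closure of $\Lambda^{CC}$ at which the utility equals $v$ are exactly the vectors in the closure of the stability region at which it equals $v$; there is at least one such vector. -/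

import Mathlib

open MeasureTheory Filter Topology
open scoped NNReal ENNReal

noncomputable section

/-- The nonempty sets of users: the `2 ^ K - 1` possible multicast groups. -/
abbrev UserGroup (K : ℕ) : Type := {J : Finset (Fin K) // J.Nonempty}

/-- Parameters of the content delivery system with `K` users. -/
structure CachingSystem (K : ℕ) where
  /-- number of channel states; the finite state space is `Fin numStates` -/
  numStates : ℕ
  /-- `gain s k` is the fading gain of user `k` when the channel is in state `s` -/
  gain : Fin numStates → Fin K → ℝ
  gain_pos : ∀ s k, 0 < gain s k
  /-- `φ s` is the probability of the channel state `s` in a slot -/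
  φ : Fin numStates → ℝ
  φ_nonneg : ∀ s, 0 ≤ φ s
  φ_sum : ∑ s, φ s = 1
  /-- transmit power -/
  P : ℝ
  P_pos : 0 < P
  /-- channel uses per slot -/
  Tslot : ℝ
  Tslot_pos : 0 < Tslot
  /-- file size in bits -/
  F : ℝ
  F_pos : 0 < F
  /-- normalized cache memory -/
  m : ℝ
  m_nonneg : 0 ≤ m
  m_le_one : m ≤ 1
  /-- largest number of combinations per slot and user set -/
  σmax : ℕ
  σmax_pos : 0 < σmax

/-- The users listed by decreasing gain (ties broken by index): `gainOrder h 0` is the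
strongest user. -/
def gainOrder {K : ℕ} (h : Fin K → ℝ) : Equiv.Perm (Fin K) :=
  Tuple.sort fun k => -h k

/-- Multicast capacity region (in bits per channel use) of the degraded Gaussian broadcast
channel with gains `h`, power `P` and one message for each nonempty set of users. The index
`i` runs over the users from the strongest to the weakest one. -/
def capacityRegion {K : ℕ} (P : ℝ) (h : Fin K → ℝ) : Set (UserGroup K → ℝ) :=
  {R | (∀ J, 0 ≤ R J) ∧
    ∃ p : Fin K → ℝ, (∀ i, 0 ≤ p i) ∧ ∑ i, p i ≤ P ∧
      ∀ i : Fin K,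
        ∑ J : UserGroup K with gainOrder h i ∈ J.1 ∧
            J.1 ⊆ (Finset.Iic i).map (gainOrder h).toEmbedding, R J
          ≤ Real.logb 2 ((1 + h (gainOrder h i) * ∑ j ∈ Finset.Iic i, p j) /
              (1 + h (gainOrder h i) * ∑ j ∈ Finset.Iio i, p j))}

/-- Backlog of a user queue (in files), initially empty, with `a t` files admitted and `c t`
files requested for combination in slot `t` (truncated subtraction is the positive part). -/
def userBacklog (a c : ℕ → ℕ) : ℕ → ℕ
  | 0 => 0
  | t + 1 => (userBacklog a c t - c t) + a t

/-- Backlog of a codeword queue (in bits), initially empty, with `arr t` bits arriving and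
service offered for `srv t` bits in slot `t`. -/
def codewordBacklog (arr srv : ℕ → ℝ) : ℕ → ℝ
  | 0 => 0
  | t + 1 => max (codewordBacklog arr srv t - srv t) 0 + arr t

namespace CachingSystem

variable {K : ℕ} (sys : CachingSystem K)

/-- Length in bits of the codeword for the group `I ⊆ J` when decentralized coded caching is
applied to one file for each user of `J`. A bit of the file of `k ∈ I` belongs to it
if, among the users of `J`, exactly those in `I \ {k}` have cached that bit. -/
def b (J I : UserGroup K) : ℝ :=
  sys.m ^ (I.1.card - 1) * (1 - sys.m) ^ (J.1.card - I.1.card + 1) * sys.F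

/-- The set of average rate vectors `∑ s, φ s • Γ(h s)`. -/
def ergodicCapacity : Set (UserGroup K → ℝ) :=
  {μ | ∃ ν : Fin sys.numStates → UserGroup K → ℝ,
    (∀ s, ν s ∈ capacityRegion sys.P (sys.gain s)) ∧ μ = ∑ s, sys.φ s • ν s}

/-- The region `Γ^CC`. Rate vectors live in the nonnegative orthant. -/
def Γcc : Set (Fin K → ℝ≥0) :=
  {a | ∃ μ ∈ sys.ergodicCapacity, ∃ σ : UserGroup K → ℝ,
    (∀ J, 0 ≤ σ J ∧ σ J ≤ sys.σmax) ∧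
    (∀ k, (a k : ℝ) ≤ ∑ J : UserGroup K with k ∈ J.1, σ J) ∧
    (∀ I : UserGroup K,
      ∑ J : UserGroup K with I.1 ⊆ J.1, sys.b J I * σ J ≤ sys.Tslot * μ I)}

/-- A file admission, combining and transmission scheme over the i.i.d. fading channel.
Decisions in slot `t` may depend on the past, on the current channel state and on additional
randomness, but not on future channel states. -/
structure Scheme where
  Ω : Type
  [mΩ : MeasurableSpace Ω]
  prob : Measure Ω
  [isProb : IsProbabilityMeasure prob]
  /-- information available in slot `t` -/
  ℱ : Filtration ℕ mΩ
  /-- channel state in slot `t` -/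
  h : ℕ → Ω → Fin sys.numStates
  h_adapted : ∀ t, Measurable[ℱ t] (h t)
  h_law : ∀ t s, prob (h t ⁻¹' {s}) = ENNReal.ofReal (sys.φ s)
  h_indep : ∀ t, ProbabilityTheory.Indep (ℱ t) (MeasurableSpace.comap (h (t + 1)) ⊤) prob
  /-- number of files admitted for each user -/
  a : ℕ → Ω → Fin K → ℕ
  a_adapted : ∀ t, Measurable[ℱ t] (a t)
  /-- number of combinations made for each group -/
  σ : ℕ → Ω → UserGroup K → ℕ
  σ_adapted : ∀ t, Measurable[ℱ t] (σ t)
  σ_le : ∀ t ω J, σ t ω J ≤ sys.σmax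
  /-- multicast rates in bits per channel use -/
  μ : ℕ → Ω → UserGroup K → ℝ
  μ_adapted : ∀ t, Measurable[ℱ t] (μ t)
  μ_mem : ∀ t ω, μ t ω ∈ capacityRegion sys.P (sys.gain (h t ω))
  /-- `x t ω k J` is the number of files of user `k` that are put into the combinations for the
  group `J`. Combinations in excess of the backlog contain no file of that user. -/
  x : ℕ → Ω → Fin K → UserGroup K → ℕ
  x_adapted : ∀ t, Measurable[ℱ t] (x t)
  x_le : ∀ t ω k J, x t ω k J ≤ if k ∈ J.1 then σ t ω J else 0
  x_sum : ∀ t ω k, ∑ J, x t ω k J =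
    min (userBacklog (fun s => a s ω k)
          (fun s => ∑ J : UserGroup K with k ∈ J.1, σ s ω J) t)
      (∑ J : UserGroup K with k ∈ J.1, σ t ω J)

attribute [instance] Scheme.mΩ Scheme.isProb

namespace Scheme

variable {sys}
variable (π : Scheme sys)

/-- Backlog `S_k(t)` of the user queue of `k`. -/
def S (k : Fin K) (t : ℕ) (ω : π.Ω) : ℕ :=
  userBacklog (fun s => π.a s ω k)
    (fun s => ∑ J : UserGroup K with k ∈ J.1, π.σ s ω J) t

/-- Bits put into the codeword queue of `I` in slot `t`. -/
def arrivals (I : UserGroup K) (t : ℕ) (ω : π.Ω) : ℝ :=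
  ∑ J : UserGroup K with I.1 ⊆ J.1, sys.b J I * π.σ t ω J

/-- Backlog `Q_I(t)` of the codeword queue of `I`. -/
def Q (I : UserGroup K) (t : ℕ) (ω : π.Ω) : ℝ :=
  codewordBacklog (fun s => π.arrivals I s ω) (fun s => sys.Tslot * π.μ s ω I) t

/-- Bits put into the codeword queue of `I` before slot `t`. -/
def created (I : UserGroup K) (t : ℕ) (ω : π.Ω) : ℝ :=
  ∑ s ∈ Finset.range t, π.arrivals I s ω

/-- Bits that have left the codeword queue of `I` before slot `t`. -/
def sent (I : UserGroup K) (t : ℕ) (ω : π.Ω) : ℝ :=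
  π.created I t ω - π.Q I t ω

/-- All codewords put into the queue of `I` in slot `s` have been multicast before slot `t`.
Codeword queues are first-in-first-out. -/
def Transmitted (I : UserGroup K) (s t : ℕ) (ω : π.Ω) : Prop :=
  π.created I (s + 1) ω ≤ π.sent I t ω

open Classical in
/-- Number `D_k(t)` of files delivered to user `k` before slot `t`. A file combined in slot `s`
for the group `J` is delivered to `k` once all the codewords intended for `k` among those
of the combination have been multicast. -/
def delivered (k : Fin K) (t : ℕ) (ω : π.Ω) : ℕ :=
  ∑ s ∈ Finset.range t, ∑ J : UserGroup K,
    if ∀ I : UserGroup K, k ∈ I.1 → I.1 ⊆ J.1 → π.Transmitted I s t ω then π.x s ω k J else 0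

open Classical in
/-- Those files among the ones of user `k` whose combination has been carried through: all its
codewords, including those intended for other users only, have been multicast. -/
def carriedThrough (k : Fin K) (t : ℕ) (ω : π.Ω) : ℕ :=
  ∑ s ∈ Finset.range t, ∑ J : UserGroup K,
    if ∀ I : UserGroup K, I.1 ⊆ J.1 → π.Transmitted I s t ω then π.x s ω k J else 0

/-- Codeword generation is irrevocable: a combination out of which some user has been served
is not abandoned. In the long run the combinations that serve a user but are
carried through only in part have rate zero. -/
def Irrevocable : Prop :=
  ∀ᵐ ω ∂π.prob, ∀ k, Tendsto
    (fun t : ℕ => ((π.delivered k t ω : ℝ) - (π.carriedThrough k t ω : ℝ)) / (t : ℝ))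
    atTop (𝓝 0)

/-- The scheme has the delivery rate vector `r`. -/
def HasDeliveryRate (r : Fin K → ℝ≥0) : Prop :=
  ∀ᵐ ω ∂π.prob, ∀ k,
    liminf (fun t : ℕ => (π.delivered k t ω : ℝ≥0∞) / (t : ℝ≥0∞)) atTop = (r k : ℝ≥0∞)

/-- The scheme has the (long-term expected) admission rate vector `a`. -/
def HasAdmissionRate (a : Fin K → ℝ≥0) : Prop :=
  ∀ k, Tendsto
    (fun T : ℕ => (∑ t ∈ Finset.range T, ∫⁻ ω, (π.a t ω k : ℝ≥0∞) ∂π.prob) / (T : ℝ≥0∞))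
    atTop (𝓝 (a k : ℝ≥0∞))

/-- All user queues and codeword queues are strongly stable. -/
def Stable : Prop :=
  (∀ k, limsup (fun T : ℕ =>
      (∑ t ∈ Finset.range T, ∫⁻ ω, (π.S k t ω : ℝ≥0∞) ∂π.prob) / (T : ℝ≥0∞)) atTop < ⊤) ∧
  (∀ I, limsup (fun T : ℕ =>
      (∑ t ∈ Finset.range T, ∫⁻ ω, ENNReal.ofReal (π.Q I t ω) ∂π.prob) / (T : ℝ≥0∞)) atTop < ⊤)

end Scheme

/-- The region `Λ^CC` of feasible delivery rate vectors. -/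
def Λcc : Set (Fin K → ℝ≥0) :=
  {r | ∃ π : Scheme sys, π.Irrevocable ∧ π.HasDeliveryRate r}

/-- The delivery rate vectors of all schemes, including those that abandon combinations
half-way. -/
def ΛccRevocable : Set (Fin K → ℝ≥0) :=
  {r | ∃ π : Scheme sys, π.HasDeliveryRate r}

/-- The stability region of the queueing system. -/
def stabilityRegion : Set (Fin K → ℝ≥0) :=
  {a | ∃ π : Scheme sys, π.HasAdmissionRate a ∧ π.Stable}

end CachingSystem

/-- The alpha-fair utility function, shifted by `d`. -/
def alphaFair (α d x : ℝ) : ℝ :=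
  if α = 1 then Real.log (1 + x / d) else (d + x) ^ (1 - α) / (1 - α)

/-- Total utility of a rate vector. -/
def totalUtility {K : ℕ} (α d : Fin K → ℝ) (r : Fin K → ℝ≥0) : ℝ :=
  ∑ k, alphaFair (α k) (d k) (r k)

end

noncomputable section

/-!
Reducing the powers as far as possible turns the degraded broadcast constraints into equalities:
nonnegative rates are achievable iff the power they require, a convex function that increases with
the tail rates, is at most `P`. Hence the capacity region is convex, compact, and closed under
handing the rate of a group to a subgroup, and `Γcc` is compact, convex and down-closed with
nonempty interior. It therefore suffices to place each operational region between the interior of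
`Γcc` and `Γcc`: all closures are then equal to `Γcc`, and continuous utilities have the same
suprema and maximizers.

Outer bounds: the empirical transmission rates and combination frequencies of a scheme satisfy the
inequalities that define `Γcc`, up to an error that vanishes with time. For delivery rates, only
the files actually delivered are counted. A combination some of whose codewords are never
transmitted is charged to the group of users it really serves; the bound `σmax` survives this
regrouping because almost all combinations are carried through, or because the channel is too weak
to serve a user with more than `σmax` combinations per slot.

Inner bound: an interior point leaves slack in every codeword queue with input. Admissions and
combinations follow the increments of `⌊c t⌋` and only the transmission rates depend on the
channel, so that the user queues stay bounded, and a quadratic drift argument together with the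
law of large numbers makes the codeword queues strongly stable and sublinear.
-/

/-! ### The capacity region as a sublevel set of the required power -/

lemma sum_range_sum_mul_sub (c E : ℕ → ℝ) (K : ℕ) :
    ∑ i ∈ Finset.range K, (∑ j ∈ Finset.range (i + 1), c j) * (E i - E (i + 1)) =
      ∑ i ∈ Finset.range K, c i * (E i - E K) := by
  induction K with
  | zero => simp
  | succ K ih =>
    rw [Finset.sum_range_succ, ih, Finset.sum_mul,
      Finset.sum_range_succ (fun j => c j * (E K - E (K + 1))),
      Finset.sum_range_succ (fun i => c i * (E i - E (K + 1))), ← add_assoc,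
      ← Finset.sum_add_distrib]
    congr 1
    exact Finset.sum_congr rfl fun i _ => by ring

/-- The products `E i * q i` of the cumulative powers `q i` telescope, and the least cumulative
powers turn all the constraints into equalities. -/
lemma exists_cumulativePower_iff {K : ℕ} {P : ℝ} {n E : ℕ → ℝ} (hn : ∀ i < K, 0 ≤ n i)
    (hE : ∀ i, 0 < E i) (hanti : ∀ i < K, E (i + 1) ≤ E i) (hEK : E K = 1) :
    (∃ q : ℕ → ℝ, q 0 = 0 ∧ (∀ i < K, q i ≤ q (i + 1)) ∧ q K ≤ P ∧
      ∀ i < K, E i * (n i + q i) ≤ E (i + 1) * (n i + q (i + 1))) ↔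
    ∑ i ∈ Finset.range K, n i * (E i - E (i + 1)) ≤ P := by
  constructor
  · rintro ⟨q, hq0, -, hqP, hq⟩
    calc ∑ i ∈ Finset.range K, n i * (E i - E (i + 1))
        ≤ ∑ i ∈ Finset.range K, (E (i + 1) * q (i + 1) - E i * q i) :=
          Finset.sum_le_sum fun i hi => by linarith [hq i (Finset.mem_range.1 hi)]
      _ = q K := by
          rw [Finset.sum_range_sub (fun i => E i * q i), hEK, hq0, one_mul, mul_zero, sub_zero]
      _ ≤ P := hqP
  · intro hP
    set w : ℕ → ℝ := fun m => ∑ i ∈ Finset.range m, n i * (E i - E (i + 1))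
    have hw : ∀ m, w (m + 1) = w m + n m * (E m - E (m + 1)) := fun m =>
      Finset.sum_range_succ _ m
    have hstep : ∀ i < K, 0 ≤ n i * (E i - E (i + 1)) := fun i hi =>
      mul_nonneg (hn i hi) (sub_nonneg.2 (hanti i hi))
    have hw0 : ∀ i < K, 0 ≤ w i := fun i hi =>
      Finset.sum_nonneg fun j hj => hstep j ((Finset.mem_range.1 hj).trans hi)
    have hEw : ∀ m, E m * (w m / E m) = w m := fun m => mul_div_cancel₀ _ (hE m).ne'
    refine ⟨fun m => w m / E m, by simp [w], fun i hi => ?_, by simpa [hEK] using hP,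
      fun i _ => le_of_eq ?_⟩
    · exact div_le_div₀ (by linarith [hw0 i hi, hw i, hstep i hi])
        (by linarith [hw i, hstep i hi]) (hE _) (hanti i hi)
    · rw [mul_add, mul_add, hEw, hEw, hw]
      ring

lemma sum_fin_lt_eq_sum_range {K m : ℕ} (hm : m ≤ K) (f : ℕ → ℝ) :
    ∑ j : Fin K with j.val < m, f j.val = ∑ j ∈ Finset.range m, f j := by
  rw [Finset.sum_filter, Fin.sum_univ_eq_sum_range (fun j => if j < m then f j else 0),
    ← Finset.sum_filter]
  congr 1
  ext j
  simp only [Finset.mem_filter, Finset.mem_range]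
  omega

lemma sub_le_logb_div_iff {g a b s t : ℝ} (hg : 0 < g) (ha : 0 ≤ a) (hb : 0 ≤ b) :
    s - t ≤ Real.logb 2 ((1 + g * b) / (1 + g * a)) ↔
      (2 : ℝ) ^ s * (g⁻¹ + a) ≤ (2 : ℝ) ^ t * (g⁻¹ + b) := by
  have hscale : ∀ c, 1 + g * c = g * (g⁻¹ + c) := fun c => by field_simp
  rw [Real.le_logb_iff_rpow_le one_lt_two (by positivity), hscale, hscale,
    mul_div_mul_left _ _ hg.ne', le_div_iff₀ (by positivity), Real.rpow_sub two_pos,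
    div_mul_eq_mul_div, div_le_iff₀ (by positivity), mul_comm (_ + b)]

section UserTotal

variable {K : ℕ}

/-- Total of a vector indexed by the groups over the groups that contain the user `k`. -/
def userTotal (k : Fin K) : (UserGroup K → ℝ) →ₗ[ℝ] ℝ :=
  ∑ J : UserGroup K with k ∈ J.1, LinearMap.proj J

lemma userTotal_apply (k : Fin K) (v : UserGroup K → ℝ) :
    userTotal k v = ∑ J : UserGroup K with k ∈ J.1, v J := by
  simp [userTotal]

lemma userTotal_le_userTotal (k : Fin K) {v w : UserGroup K → ℝ} (h : ∀ J, v J ≤ w J) :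
    userTotal k v ≤ userTotal k w := by
  simp only [userTotal_apply]
  exact Finset.sum_le_sum fun J _ => h J

lemma le_userTotal {k : Fin K} {v : UserGroup K → ℝ} (hv : ∀ J, 0 ≤ v J) {J : UserGroup K}
    (hk : k ∈ J.1) : v J ≤ userTotal k v := by
  rw [userTotal_apply]
  exact Finset.single_le_sum (fun J _ => hv J) (by simpa using hk)

lemma userTotal_natCast (k : Fin K) (n : UserGroup K → ℕ) :
    userTotal k (fun J => (n J : ℝ)) = ↑(∑ J : UserGroup K with k ∈ J.1, n J) := by
  rw [userTotal_apply, Nat.cast_sum]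

end UserTotal

section CapacityRegion

variable {K : ℕ}

/-- Total rate of the groups that contain one of the users in the positions `i, i + 1, …`
of the gain order. -/
def tailRate (h : Fin K → ℝ) (i : ℕ) : (UserGroup K → ℝ) →ₗ[ℝ] ℝ :=
  ∑ J : UserGroup K with ∃ j : Fin K, i ≤ j ∧ gainOrder h j ∈ J.1, LinearMap.proj J

/-- Noise-to-gain ratios in the gain order, shifted by one so as to start from `0`: the user in
position `i` has the ratio `noiseLevel h (i + 1)`. -/
def noiseLevel (h : Fin K → ℝ) : ℕ → ℝ
  | 0 => 0
  | i + 1 => if hi : i < K then (h (gainOrder h ⟨i, hi⟩))⁻¹ else 0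

/-- The least power at which superposition coding supports the rates `R`. After summation by
parts, the coefficients are the nonnegative increments of the noise level. -/
def requiredPower (h : Fin K → ℝ) (R : UserGroup K → ℝ) : ℝ :=
  ∑ i ∈ Finset.range K, (noiseLevel h (i + 1) - noiseLevel h i) * ((2 : ℝ) ^ tailRate h i R - 1)

lemma tailRate_apply (h : Fin K → ℝ) (i : ℕ) (R : UserGroup K → ℝ) :
    tailRate h i R = ∑ J : UserGroup K with ∃ j : Fin K, i ≤ j ∧ gainOrder h j ∈ J.1, R J := by
  simp [tailRate]

lemma tailRate_last (h : Fin K → ℝ) (R : UserGroup K → ℝ) : tailRate h K R = 0 := by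
  rw [tailRate_apply, Finset.filter_false_of_mem, Finset.sum_empty]
  rintro J - ⟨j, hj, -⟩
  omega

lemma tailRate_nonneg (h : Fin K → ℝ) {R : UserGroup K → ℝ} (hR : ∀ J, 0 ≤ R J) (i : ℕ) :
    0 ≤ tailRate h i R := by
  rw [tailRate_apply]
  exact Finset.sum_nonneg fun J _ => hR J

lemma tailRate_antitone (h : Fin K → ℝ) {R : UserGroup K → ℝ} (hR : ∀ J, 0 ≤ R J) :
    Antitone fun i => tailRate h i R := fun i l hil => by
  simp only [tailRate_apply]
  exact Finset.sum_le_sum_of_subset_of_nonneg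
    (Finset.monotone_filter_right _ fun J _ ⟨j, hj, hjJ⟩ => ⟨j, hil.trans hj, hjJ⟩)
    fun J _ _ => hR J

lemma tailRate_sub_tailRate_succ (h : Fin K → ℝ) (R : UserGroup K → ℝ) (i : Fin K) :
    tailRate h i R - tailRate h (i + 1) R =
      ∑ J : UserGroup K with gainOrder h i ∈ J.1 ∧
        J.1 ⊆ (Finset.Iic i).map (gainOrder h).toEmbedding, R J := by
  have hbelow : ∀ J : UserGroup K, J.1 ⊆ (Finset.Iic i).map (gainOrder h).toEmbedding ↔
      ¬ ∃ j : Fin K, (i : ℕ) + 1 ≤ j ∧ gainOrder h j ∈ J.1 := fun J => by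
    rw [not_exists, Finset.subset_iff, ← (gainOrder h).forall_congr_right]
    refine forall_congr' fun j => ?_
    rw [Finset.mem_map_equiv, Equiv.symm_apply_apply, Finset.mem_Iic, Fin.le_def, not_and',
      not_le, Nat.lt_succ_iff]
  have htail : ∀ J : UserGroup K, (∃ j : Fin K, (i : ℕ) ≤ j ∧ gainOrder h j ∈ J.1) ↔
      gainOrder h i ∈ J.1 ∨ ∃ j : Fin K, (i : ℕ) + 1 ≤ j ∧ gainOrder h j ∈ J.1 := fun J => by
    refine ⟨fun ⟨j, hj, hjJ⟩ => ?_, ?_⟩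
    · rcases hj.eq_or_lt with hij | hij
      · exact Or.inl (Fin.ext hij ▸ hjJ)
      · exact Or.inr ⟨j, hij, hjJ⟩
    · rintro (hi | ⟨j, hj, hjJ⟩)
      exacts [⟨i, le_rfl, hi⟩, ⟨j, (Nat.le_succ _).trans hj, hjJ⟩]
  simp only [tailRate_apply, hbelow, htail, Finset.sum_filter, ← Finset.sum_sub_distrib]
  refine Finset.sum_congr rfl fun J _ => ?_
  split_ifs <;> grind

lemma noiseLevel_succ (h : Fin K → ℝ) (i : Fin K) :
    noiseLevel h (i + 1) = (h (gainOrder h i))⁻¹ := by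
  simp [noiseLevel]

lemma noiseLevel_le_succ {h : Fin K → ℝ} (hpos : ∀ k, 0 < h k) {i : ℕ} (hi : i < K) :
    noiseLevel h i ≤ noiseLevel h (i + 1) := by
  rcases i with _ | i
  · simpa [noiseLevel, hi] using (hpos _).le
  · have hsorted := Tuple.monotone_sort (fun k => -h k)
      (show (⟨i, by omega⟩ : Fin K) ≤ ⟨i + 1, hi⟩ from Nat.le_succ i)
    rw [show i + 1 = ((⟨i, by omega⟩ : Fin K) : ℕ) + 1 from rfl, noiseLevel_succ,
      show i + 1 = ((⟨i + 1, hi⟩ : Fin K) : ℕ) from rfl, noiseLevel_succ]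
    exact inv_anti₀ (hpos _) (neg_le_neg_iff.1 hsorted)

lemma requiredPower_eq_sum_noiseLevel_mul (h : Fin K → ℝ) (R : UserGroup K → ℝ) :
    requiredPower h R = ∑ i ∈ Finset.range K,
      noiseLevel h (i + 1) * ((2 : ℝ) ^ tailRate h i R - (2 : ℝ) ^ tailRate h (i + 1) R) := by
  have hlast : (2 : ℝ) ^ tailRate h K R = 1 := by rw [tailRate_last, Real.rpow_zero]
  have hparts := sum_range_sum_mul_sub (fun j => noiseLevel h (j + 1) - noiseLevel h j)
    (fun i => (2 : ℝ) ^ tailRate h i R) K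
  simp only [Finset.sum_range_sub, hlast] at hparts
  simpa [requiredPower, noiseLevel] using hparts.symm

lemma mem_capacityRegion_iff_cumulativePower {P : ℝ} {h : Fin K → ℝ} (hpos : ∀ k, 0 < h k)
    {R : UserGroup K → ℝ} :
    R ∈ capacityRegion P h ↔ (∀ J, 0 ≤ R J) ∧
      ∃ q : ℕ → ℝ, q 0 = 0 ∧ (∀ i < K, q i ≤ q (i + 1)) ∧ q K ≤ P ∧
        ∀ i < K, (2 : ℝ) ^ tailRate h i R * (noiseLevel h (i + 1) + q i) ≤
          (2 : ℝ) ^ tailRate h (i + 1) R * (noiseLevel h (i + 1) + q (i + 1)) := by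
  have hIic : ∀ i : Fin K, Finset.Iic i =
      Finset.univ.filter fun j => j.val < i.val + 1 := fun i => by
    ext j; rw [Finset.mem_Iic, Finset.mem_filter_univ, Fin.le_def, Nat.lt_succ_iff]
  have hIio : ∀ i : Fin K, Finset.Iio i =
      Finset.univ.filter fun j => j.val < i.val := fun i => by
    ext j; rw [Finset.mem_Iio, Finset.mem_filter_univ, Fin.lt_def]
  refine and_congr_right' ⟨?_, ?_⟩
  · rintro ⟨p, hp, hpP, hrate⟩
    have hsum : ∀ s : Finset (Fin K), 0 ≤ ∑ j ∈ s, p j := fun s =>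
      Finset.sum_nonneg fun j _ => hp j
    refine ⟨fun m => ∑ j : Fin K with j.val < m, p j, by simp, fun i _ => ?_,
      by simpa using hpP, fun i hi => ?_⟩
    · exact Finset.sum_le_sum_of_subset_of_nonneg
        (Finset.monotone_filter_right _ fun j _ hj => Nat.lt_succ_of_lt hj) fun j _ _ => hp j
    · have h1 := hrate ⟨i, hi⟩
      rwa [← tailRate_sub_tailRate_succ, sub_le_logb_div_iff (hpos _) (hsum _) (hsum _),
        ← noiseLevel_succ, hIic, hIio] at h1
  · rintro ⟨q, hq0, hqmono, hqP, hq⟩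
    have hcum : ∀ m ≤ K, ∑ j : Fin K with j.val < m, (q (j.val + 1) - q j.val) = q m := by
      intro m hm
      rw [sum_fin_lt_eq_sum_range hm (fun j => q (j + 1) - q j), Finset.sum_range_sub, hq0,
        sub_zero]
    have hp : ∀ j : Fin K, 0 ≤ q (j + 1) - q j := fun j => sub_nonneg.2 (hqmono j j.2)
    refine ⟨fun j => q (j + 1) - q j, hp, ?_, fun i => ?_⟩
    · simpa using (hcum K le_rfl).trans_le hqP
    · have hqi : ∀ m ≤ K, 0 ≤ q m := fun m hm => hcum m hm ▸ Finset.sum_nonneg fun j _ => hp j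
      rw [← tailRate_sub_tailRate_succ, hIic, hIio, hcum _ i.2, hcum _ i.2.le,
        sub_le_logb_div_iff (hpos _) (hqi _ i.2.le) (hqi _ i.2), ← noiseLevel_succ]
      exact hq i i.2

theorem mem_capacityRegion_iff {P : ℝ} {h : Fin K → ℝ} (hpos : ∀ k, 0 < h k)
    {R : UserGroup K → ℝ} :
    R ∈ capacityRegion P h ↔ (∀ J, 0 ≤ R J) ∧ requiredPower h R ≤ P := by
  rw [mem_capacityRegion_iff_cumulativePower hpos]
  refine and_congr_right fun hR => ?_
  rw [requiredPower_eq_sum_noiseLevel_mul]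
  refine exists_cumulativePower_iff (fun i hi => ?_) (fun i => by positivity) (fun i _ => ?_) ?_
  · have := noiseLevel_succ h ⟨i, hi⟩
    exact this ▸ (inv_pos.2 (hpos _)).le
  · exact Real.rpow_le_rpow_of_exponent_le one_le_two (tailRate_antitone h hR (Nat.le_succ i))
  · rw [tailRate_last, Real.rpow_zero]

lemma requiredPower_mono {h : Fin K → ℝ} (hpos : ∀ k, 0 < h k) {R R' : UserGroup K → ℝ}
    (hle : ∀ i, tailRate h i R ≤ tailRate h i R') : requiredPower h R ≤ requiredPower h R' :=
  Finset.sum_le_sum fun i hi => mul_le_mul_of_nonneg_left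
    (sub_le_sub_right (Real.rpow_le_rpow_of_exponent_le one_le_two (hle i)) 1)
    (sub_nonneg.2 (noiseLevel_le_succ hpos (Finset.mem_range.1 hi)))

lemma convexOn_requiredPower {h : Fin K → ℝ} (hpos : ∀ k, 0 < h k) :
    ConvexOn ℝ Set.univ (requiredPower h) := by
  have hterm : ∀ i, ConvexOn ℝ Set.univ fun R : UserGroup K → ℝ => (2 : ℝ) ^ tailRate h i R - 1 :=
    fun i => ConvexOn.sub ((convexOn_rpow_left two_pos).comp_linearMap (tailRate h i))
      (concaveOn_const 1 convex_univ)
  refine ⟨convex_univ, fun R _ R' _ a b ha hb hab => ?_⟩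
  simp only [requiredPower, smul_eq_mul, Finset.mul_sum, ← Finset.sum_add_distrib]
  refine Finset.sum_le_sum fun i hi => ?_
  have := ((hterm i).smul (sub_nonneg.2 (noiseLevel_le_succ hpos (Finset.mem_range.1 hi)))).2
    (Set.mem_univ R) (Set.mem_univ R') ha hb hab
  simpa only [smul_eq_mul] using this

lemma continuous_requiredPower (h : Fin K → ℝ) : Continuous (requiredPower h) :=
  continuous_finsetSum _ fun i _ => continuous_const.mul
    ((continuous_const.rpow (tailRate h i).continuous_of_finiteDimensional
      fun _ => Or.inl two_ne_zero).sub continuous_const)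

lemma requiredPower_zero (h : Fin K → ℝ) : requiredPower h 0 = 0 := by
  simp [requiredPower]

lemma noiseLevel_mul_le_requiredPower {h : Fin K → ℝ} (hpos : ∀ k, 0 < h k)
    {R : UserGroup K → ℝ} (hR : ∀ J, 0 ≤ R J) {i : ℕ} (hi : i < K) :
    noiseLevel h (i + 1) * ((2 : ℝ) ^ tailRate h i R - 1) ≤ requiredPower h R := by
  have hincr : ∀ j < K, 0 ≤ noiseLevel h (j + 1) - noiseLevel h j := fun j hj =>
    sub_nonneg.2 (noiseLevel_le_succ hpos hj)
  have hrange : Finset.range (i + 1) ⊆ Finset.range K := Finset.range_subset_range.2 hi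
  calc noiseLevel h (i + 1) * ((2 : ℝ) ^ tailRate h i R - 1)
      = ∑ j ∈ Finset.range (i + 1),
          (noiseLevel h (j + 1) - noiseLevel h j) * ((2 : ℝ) ^ tailRate h i R - 1) := by
        rw [← Finset.sum_mul, Finset.sum_range_sub (noiseLevel h)]
        simp [noiseLevel]
    _ ≤ ∑ j ∈ Finset.range (i + 1),
          (noiseLevel h (j + 1) - noiseLevel h j) * ((2 : ℝ) ^ tailRate h j R - 1) := by
        refine Finset.sum_le_sum fun j hj => mul_le_mul_of_nonneg_left
          (sub_le_sub_right (Real.rpow_le_rpow_of_exponent_le one_le_two ?_) 1)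
          (hincr j (Finset.mem_range.1 (hrange hj)))
        exact tailRate_antitone h hR (Nat.lt_succ_iff.1 (Finset.mem_range.1 hj))
    _ ≤ requiredPower h R :=
        Finset.sum_le_sum_of_subset_of_nonneg hrange fun j hj _ =>
          mul_nonneg (hincr j (Finset.mem_range.1 hj))
            (sub_nonneg.2 (Real.one_le_rpow one_le_two (tailRate_nonneg h hR j)))

theorem convex_capacityRegion {P : ℝ} {h : Fin K → ℝ} (hpos : ∀ k, 0 < h k) :
    Convex ℝ (capacityRegion P h) := by
  have hinter : capacityRegion P h = Set.Ici 0 ∩ {R ∈ Set.univ | requiredPower h R ≤ P} := by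
    ext R
    simp [mem_capacityRegion_iff hpos, Pi.le_def]
  rw [hinter]
  exact (convex_Ici 0).inter ((convexOn_requiredPower hpos).convex_le P)

theorem isClosed_capacityRegion {P : ℝ} {h : Fin K → ℝ} (hpos : ∀ k, 0 < h k) :
    IsClosed (capacityRegion P h) := by
  have hinter : capacityRegion P h = Set.Ici 0 ∩ {R | requiredPower h R ≤ P} := by
    ext R
    simp [mem_capacityRegion_iff hpos, Pi.le_def]
  rw [hinter]
  exact isClosed_Ici.inter (isClosed_le (continuous_requiredPower h) continuous_const)

theorem userTotal_le_logb_of_mem_capacityRegion {P : ℝ} {h : Fin K → ℝ} (hpos : ∀ k, 0 < h k)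
    {R : UserGroup K → ℝ} (hR : R ∈ capacityRegion P h) (k : Fin K) :
    userTotal k R ≤ Real.logb 2 (1 + P * h k) := by
  obtain ⟨hR0, hRP⟩ := (mem_capacityRegion_iff hpos).1 hR
  obtain ⟨i, rfl⟩ := (gainOrder h).surjective k
  have htail : userTotal (gainOrder h i) R ≤ tailRate h i R := by
    rw [userTotal_apply, tailRate_apply]
    exact Finset.sum_le_sum_of_subset_of_nonneg
      (Finset.monotone_filter_right _ fun J _ hJ => ⟨i, le_rfl, hJ⟩) fun J _ _ => hR0 J
  have hpower : (2 : ℝ) ^ tailRate h i R ≤ 1 + P * h (gainOrder h i) := by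
    have := (noiseLevel_mul_le_requiredPower hpos hR0 i.2).trans hRP
    rw [noiseLevel_succ, inv_mul_le_iff₀ (hpos _)] at this
    linarith
  exact htail.trans ((Real.le_logb_iff_rpow_le one_lt_two
    ((Real.rpow_pos_of_pos two_pos _).trans_le hpower)).2 hpower)

theorem isCompact_capacityRegion {P : ℝ} {h : Fin K → ℝ} (hpos : ∀ k, 0 < h k) :
    IsCompact (capacityRegion P h) := by
  refine (isCompact_univ_pi fun J : UserGroup K =>
    isCompact_Icc (a := (0 : ℝ)) (b := Real.logb 2 (1 + P * h J.2.choose))).of_isClosed_subset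
    (isClosed_capacityRegion hpos) fun R hR J _ => ⟨hR.1 J, ?_⟩
  exact (le_userTotal hR.1 J.2.choose_spec).trans
    (userTotal_le_logb_of_mem_capacityRegion hpos hR J.2.choose)

theorem reassign_to_subgroups_mem_capacityRegion {P : ℝ} {h : Fin K → ℝ} (hpos : ∀ k, 0 < h k)
    {R : UserGroup K → ℝ} (hR : R ∈ capacityRegion P h) {w : UserGroup K → UserGroup K → ℝ}
    (hw : ∀ I I', 0 ≤ w I I') (hsub : ∀ I I', ¬ I'.1 ⊆ I.1 → w I I' = 0)
    (hsum : ∀ I, ∑ I', w I I' ≤ 1) :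
    (fun I' => ∑ I, w I I' * R I) ∈ capacityRegion P h := by
  obtain ⟨hR0, hRP⟩ := (mem_capacityRegion_iff hpos).1 hR
  refine (mem_capacityRegion_iff hpos).2 ⟨fun J => Finset.sum_nonneg fun I _ =>
    mul_nonneg (hw _ _) (hR0 _), (requiredPower_mono hpos fun i => ?_).trans hRP⟩
  rw [tailRate_apply, tailRate_apply, Finset.sum_comm, Finset.sum_filter]
  refine Finset.sum_le_sum fun I _ => ?_
  rw [← Finset.sum_mul]
  split_ifs with hI
  · refine mul_le_of_le_one_left (hR0 I) (le_trans ?_ (hsum I))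
    exact Finset.sum_le_sum_of_subset_of_nonneg (Finset.filter_subset _ _) fun _ _ _ => hw _ _
  · rw [Finset.sum_eq_zero, zero_mul]
    intro I' hI'
    obtain ⟨j, hj, hjI⟩ := (Finset.mem_filter.1 hI').2
    exact hsub _ _ fun hs => hI ⟨j, hj, hs hjI⟩

lemma zero_mem_capacityRegion {P : ℝ} (hP : 0 ≤ P) {h : Fin K → ℝ} (hpos : ∀ k, 0 < h k) :
    0 ∈ capacityRegion P h :=
  (mem_capacityRegion_iff hpos).2 ⟨fun _ => le_rfl, (requiredPower_zero h).trans_le hP⟩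

lemma eventually_const_mem_capacityRegion {P : ℝ} (hP : 0 < P) {h : Fin K → ℝ}
    (hpos : ∀ k, 0 < h k) :
    ∀ᶠ δ : ℝ in 𝓝[>] 0, (fun _ => δ) ∈ capacityRegion P h := by
  have hcont : Continuous fun δ : ℝ => requiredPower h fun _ => δ :=
    (continuous_requiredPower h).comp (continuous_pi fun _ => continuous_id)
  have hzero : requiredPower h (fun _ => 0) < P := (requiredPower_zero h).trans_lt hP
  filter_upwards [nhdsWithin_le_nhds ((hcont.tendsto 0).eventually (gt_mem_nhds hzero)),
    self_mem_nhdsWithin] with δ hδ hδ0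
  exact (mem_capacityRegion_iff hpos).2 ⟨fun _ => le_of_lt hδ0, hδ.le⟩

end CapacityRegion

/-! ### The ergodic capacity region -/

namespace CachingSystem

variable {K : ℕ} (sys : CachingSystem K)

theorem convex_ergodicCapacity : Convex ℝ sys.ergodicCapacity := by
  rintro _ ⟨ν, hν, rfl⟩ _ ⟨ν', hν', rfl⟩ a b ha hb hab
  refine ⟨fun s => a • ν s + b • ν' s,
    fun s => convex_capacityRegion (sys.gain_pos s) (hν s) (hν' s) ha hb hab, ?_⟩
  rw [Finset.smul_sum, Finset.smul_sum, ← Finset.sum_add_distrib]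
  refine Finset.sum_congr rfl fun s _ => ?_
  rw [smul_add, smul_comm a, smul_comm b]

theorem isCompact_ergodicCapacity : IsCompact sys.ergodicCapacity := by
  have hpi : IsCompact (Set.univ.pi fun s => capacityRegion sys.P (sys.gain s)) :=
    isCompact_univ_pi fun s => isCompact_capacityRegion (sys.gain_pos s)
  have hcont : Continuous fun ν : Fin sys.numStates → UserGroup K → ℝ => ∑ s, sys.φ s • ν s := by
    fun_prop
  convert hpi.image hcont using 1
  ext μ
  simp [ergodicCapacity, eq_comm]

lemma nonneg_of_mem_ergodicCapacity {μ : UserGroup K → ℝ} (hμ : μ ∈ sys.ergodicCapacity)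
    (J : UserGroup K) : 0 ≤ μ J := by
  obtain ⟨ν, hν, rfl⟩ := hμ
  simp only [Finset.sum_apply, Pi.smul_apply, smul_eq_mul]
  exact Finset.sum_nonneg fun s _ => mul_nonneg (sys.φ_nonneg s) ((hν s).1 J)

theorem userTotal_le_of_mem_ergodicCapacity {μ : UserGroup K → ℝ}
    (hμ : μ ∈ sys.ergodicCapacity) (k : Fin K) :
    userTotal k μ ≤ ∑ s, sys.φ s * Real.logb 2 (1 + sys.P * sys.gain s k) := by
  obtain ⟨ν, hν, rfl⟩ := hμ
  simp only [map_sum, map_smul, smul_eq_mul]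
  exact Finset.sum_le_sum fun s _ => mul_le_mul_of_nonneg_left
    (userTotal_le_logb_of_mem_capacityRegion (sys.gain_pos s) (hν s) k) (sys.φ_nonneg s)

theorem reassign_to_subgroups_mem_ergodicCapacity {μ : UserGroup K → ℝ}
    (hμ : μ ∈ sys.ergodicCapacity) {w : UserGroup K → UserGroup K → ℝ}
    (hw : ∀ I I', 0 ≤ w I I') (hsub : ∀ I I', ¬ I'.1 ⊆ I.1 → w I I' = 0)
    (hsum : ∀ I, ∑ I', w I I' ≤ 1) :
    (fun I' => ∑ I, w I I' * μ I) ∈ sys.ergodicCapacity := by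
  obtain ⟨ν, hν, rfl⟩ := hμ
  refine ⟨fun s I' => ∑ I, w I I' * ν s I, fun s =>
    reassign_to_subgroups_mem_capacityRegion (sys.gain_pos s) (hν s) hw hsub hsum, ?_⟩
  ext I'
  simp only [Finset.sum_apply, Pi.smul_apply, smul_eq_mul, Finset.mul_sum]
  rw [Finset.sum_comm]
  exact Finset.sum_congr rfl fun s _ => Finset.sum_congr rfl fun I _ => mul_left_comm _ _ _

lemma exists_rate_bound : ∃ C : ℝ, 0 ≤ C ∧ ∀ s, ∀ R ∈ capacityRegion sys.P (sys.gain s),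
    ∀ J, R J ≤ C := by
  have hbdd : Bornology.IsBounded (⋃ s, capacityRegion sys.P (sys.gain s)) :=
    (isCompact_iUnion fun s => isCompact_capacityRegion (sys.gain_pos s)).isBounded
  obtain ⟨C, hC⟩ := hbdd.exists_norm_le
  refine ⟨max C 0, le_max_right _ _, fun s R hR J => ?_⟩
  exact (le_abs_self _).trans ((norm_le_pi_norm R J).trans
    ((hC R (Set.mem_iUnion.2 ⟨s, hR⟩)).trans (le_max_left _ _)))

section Mean

variable {Ω : Type*} [MeasurableSpace Ω] {prob : Measure Ω}
  {h : Ω → Fin sys.numStates} {μ : Ω → UserGroup K → ℝ}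

theorem integrable_rates [IsFiniteMeasure prob] (hμ : Measurable μ)
    (hmem : ∀ ω, μ ω ∈ capacityRegion sys.P (sys.gain (h ω))) : Integrable μ prob := by
  obtain ⟨C, hC0, hC⟩ := sys.exists_rate_bound
  refine Integrable.of_bound (C := C) hμ.aestronglyMeasurable (ae_of_all _ fun ω => ?_)
  refine (pi_norm_le_iff_of_nonneg hC0).2 fun J => ?_
  rw [Real.norm_of_nonneg ((hmem ω).1 J)]
  exact hC _ _ (hmem ω) J

lemma setAverage_mem_capacityRegion [IsFiniteMeasure prob] (hh : Measurable h) (hμ : Measurable μ)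
    (hmem : ∀ ω, μ ω ∈ capacityRegion sys.P (sys.gain (h ω))) {s : Fin sys.numStates}
    (hs : prob (h ⁻¹' {s}) ≠ 0) :
    ⨍ ω in h ⁻¹' {s}, μ ω ∂prob ∈ capacityRegion sys.P (sys.gain s) := by
  refine (convex_capacityRegion (sys.gain_pos s)).set_average_mem
    (isClosed_capacityRegion (sys.gain_pos s)) hs (measure_ne_top _ _) ?_
    (sys.integrable_rates hμ hmem).integrableOn
  refine (ae_restrict_iff' (hh (measurableSet_singleton s))).2 (ae_of_all _ fun ω hω => ?_)
  exact Set.mem_singleton_iff.1 hω ▸ hmem ω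

theorem integral_mem_ergodicCapacity [IsFiniteMeasure prob] (hh : Measurable h)
    (hlaw : ∀ s, prob (h ⁻¹' {s}) = ENNReal.ofReal (sys.φ s)) (hμ : Measurable μ)
    (hmem : ∀ ω, μ ω ∈ capacityRegion sys.P (sys.gain (h ω))) :
    ∫ ω, μ ω ∂prob ∈ sys.ergodicCapacity := by
  have hnull : ∀ s, prob (h ⁻¹' {s}) = 0 ↔ sys.φ s = 0 := fun s => by
    rw [hlaw, ENNReal.ofReal_eq_zero, (sys.φ_nonneg s).ge_iff_eq']
  have hcover : (⋃ s, h ⁻¹' {s}) = Set.univ := by ext ω; simp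
  refine ⟨fun s => if sys.φ s = 0 then 0 else ⨍ ω in h ⁻¹' {s}, μ ω ∂prob, fun s => ?_, ?_⟩
  · beta_reduce
    split_ifs with h0
    · exact zero_mem_capacityRegion sys.P_pos.le (sys.gain_pos s)
    · exact sys.setAverage_mem_capacityRegion hh hμ hmem (mt (hnull s).1 h0)
  · rw [← setIntegral_univ, ← hcover, integral_iUnion_fintype
      (fun s => hh (measurableSet_singleton s))
      (fun s t hst => Disjoint.preimage h (by simpa using hst))
      fun s => (sys.integrable_rates hμ hmem).integrableOn]
    refine Finset.sum_congr rfl fun s _ => ?_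
    beta_reduce
    split_ifs with h0
    · rw [smul_zero, setIntegral_measure_zero _ ((hnull s).2 h0)]
    · rw [setAverage_eq, Measure.real, hlaw, ENNReal.toReal_ofReal (sys.φ_nonneg s), smul_smul,
        mul_inv_cancel₀ h0, one_smul]

end Mean

theorem average_mem_ergodicCapacity {T : ℕ} (hT : 0 < T) {μ : ℕ → UserGroup K → ℝ}
    (hμ : ∀ t, μ t ∈ sys.ergodicCapacity) :
    (T : ℝ)⁻¹ • ∑ t ∈ Finset.range T, μ t ∈ sys.ergodicCapacity := by
  rw [Finset.smul_sum]
  refine sys.convex_ergodicCapacity.sum_mem (fun _ _ => by positivity) ?_ fun t _ => hμ t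
  rw [Finset.sum_const, Finset.card_range, nsmul_eq_mul, mul_inv_cancel₀ (by positivity)]

/-! ### The region `Γcc` -/

lemma b_nonneg (J I : UserGroup K) : 0 ≤ sys.b J I :=
  mul_nonneg (mul_nonneg (pow_nonneg sys.m_nonneg _) (pow_nonneg (sub_nonneg.2 sys.m_le_one) _))
    sys.F_pos.le

/-- Bits that combinations made at the rates `σ` put into the codeword queue of `I`. -/
def load (I : UserGroup K) : (UserGroup K → ℝ) →ₗ[ℝ] ℝ :=
  ∑ J : UserGroup K with I.1 ⊆ J.1, sys.b J I • LinearMap.proj J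

lemma load_apply (I : UserGroup K) (σ : UserGroup K → ℝ) :
    sys.load I σ = ∑ J : UserGroup K with I.1 ⊆ J.1, sys.b J I * σ J := by
  simp [load]

lemma load_mono (I : UserGroup K) {σ σ' : UserGroup K → ℝ} (h : ∀ J, σ J ≤ σ' J) :
    sys.load I σ ≤ sys.load I σ' := by
  simp only [load_apply]
  exact Finset.sum_le_sum fun J _ => mul_le_mul_of_nonneg_left (h J) (sys.b_nonneg J I)

lemma load_nonneg (I : UserGroup K) {σ : UserGroup K → ℝ} (h : ∀ J, 0 ≤ σ J) :
    0 ≤ sys.load I σ := by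
  simpa using sys.load_mono I (σ := 0) h

lemma mem_Γcc_iff {a : Fin K → ℝ≥0} :
    a ∈ sys.Γcc ↔ ∃ μ ∈ sys.ergodicCapacity, ∃ σ : UserGroup K → ℝ,
      (∀ J, 0 ≤ σ J ∧ σ J ≤ sys.σmax) ∧ (∀ k, (a k : ℝ) ≤ userTotal k σ) ∧
      ∀ I, sys.load I σ ≤ sys.Tslot * μ I := by
  simp only [Γcc, userTotal_apply, load_apply, Set.mem_ofPred_eq]

theorem mem_Γcc_of_approx {a : Fin K → ℝ≥0}
    (h : ∀ ε : ℝ, 0 < ε → ∃ μ ∈ sys.ergodicCapacity, ∃ σ : UserGroup K → ℝ,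
      (∀ J, 0 ≤ σ J ∧ σ J ≤ sys.σmax) ∧ (∀ k, (a k : ℝ) - ε ≤ userTotal k σ) ∧
      ∀ I, sys.load I σ - ε ≤ sys.Tslot * μ I) :
    a ∈ sys.Γcc := by
  choose! μ hμ σ hσ huser hload using h
  set ε : ℕ → ℝ := fun n => 1 / ((n : ℝ) + 1)
  have hε : ∀ n, 0 < ε n := fun n => by positivity
  have hcompact : IsCompact (sys.ergodicCapacity ×ˢ
      (Set.univ.pi fun _ : UserGroup K => Set.Icc (0 : ℝ) sys.σmax)) :=
    sys.isCompact_ergodicCapacity.prod (isCompact_univ_pi fun _ => isCompact_Icc)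
  obtain ⟨⟨μ', σ'⟩, ⟨hμ', hσ'⟩, g, hg, hlim⟩ := hcompact.tendsto_subseq
    (x := fun n => (μ (ε n), σ (ε n))) fun n => ⟨hμ _ (hε n), fun J _ => hσ _ (hε n) J⟩
  have hεlim : Tendsto (fun n => ε (g n)) atTop (𝓝 0) :=
    tendsto_one_div_add_atTop_nhds_zero_nat.comp hg.tendsto_atTop
  have hlimσ : ∀ f : (UserGroup K → ℝ) →ₗ[ℝ] ℝ,
      Tendsto (fun n => f (σ (ε (g n)))) atTop (𝓝 (f σ')) := fun f =>
    ((f.continuous_of_finiteDimensional.comp continuous_snd).tendsto _).comp hlim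
  have hlimμ : ∀ I, Tendsto (fun n => μ (ε (g n)) I) atTop (𝓝 (μ' I)) := fun I =>
    (((continuous_apply I).comp continuous_fst).tendsto _).comp hlim
  refine sys.mem_Γcc_iff.2 ⟨μ', hμ', σ', fun J => hσ' J (Set.mem_univ J), fun k => ?_,
    fun I => ?_⟩
  · have hlower := hεlim.const_sub (a k : ℝ)
    rw [sub_zero] at hlower
    exact le_of_tendsto_of_tendsto' hlower (hlimσ (userTotal k)) fun n => huser _ (hε (g n)) k
  · have hlower := (hlimσ (sys.load I)).sub hεlim
    rw [sub_zero] at hlower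
    exact le_of_tendsto_of_tendsto' hlower ((hlimμ I).const_mul sys.Tslot)
      fun n => hload _ (hε (g n)) I

theorem isClosed_Γcc : IsClosed sys.Γcc := by
  refine isClosed_of_closure_subset fun a ha => sys.mem_Γcc_of_approx fun ε hε => ?_
  have hopen : IsOpen {c : Fin K → ℝ≥0 | ∀ k, (a k : ℝ) - ε < c k} := by
    simp only [Set.ofPred_forall]
    exact isOpen_iInter_of_finite fun k => isOpen_lt continuous_const (by fun_prop)
  obtain ⟨c, hac, hc⟩ := mem_closure_iff.1 ha _ hopen fun k => by linarith
  obtain ⟨μ, hμ, σ, hσ, huser, hload⟩ := sys.mem_Γcc_iff.1 hc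
  exact ⟨μ, hμ, σ, hσ, fun k => (hac k).le.trans (huser k), fun I => by linarith [hload I]⟩

theorem isCompact_Γcc : IsCompact sys.Γcc := by
  refine (isCompact_univ_pi fun k : Fin K => isCompact_Icc (a := (0 : ℝ≥0))
    (b := (userTotal k fun _ => (sys.σmax : ℝ)).toNNReal)).of_isClosed_subset sys.isClosed_Γcc ?_
  intro a ha k _
  obtain ⟨μ, -, σ, hσ, huser, -⟩ := sys.mem_Γcc_iff.1 ha
  exact ⟨zero_le, NNReal.le_toNNReal_of_coe_le
    ((huser k).trans (userTotal_le_userTotal k fun J => (hσ J).2))⟩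

lemma mem_Γcc_of_le {a c : Fin K → ℝ≥0} (ha : a ∈ sys.Γcc) (hca : c ≤ a) : c ∈ sys.Γcc := by
  obtain ⟨μ, hμ, σ, hσ, huser, hload⟩ := sys.mem_Γcc_iff.1 ha
  exact sys.mem_Γcc_iff.2
    ⟨μ, hμ, σ, hσ, fun k => (NNReal.coe_le_coe.2 (hca k)).trans (huser k), hload⟩

theorem convex_Γcc : Convex ℝ≥0 sys.Γcc := by
  intro a ha a' ha' x y _ _ hxy
  obtain ⟨μ, hμ, σ, hσ, huser, hload⟩ := sys.mem_Γcc_iff.1 ha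
  obtain ⟨μ', hμ', σ', hσ', huser', hload'⟩ := sys.mem_Γcc_iff.1 ha'
  have hxy' : (x : ℝ) + y = 1 := by exact_mod_cast hxy
  have hbox : Convex ℝ (Set.Icc (0 : ℝ) sys.σmax) := convex_Icc _ _
  refine sys.mem_Γcc_iff.2 ⟨(x : ℝ) • μ + (y : ℝ) • μ',
    sys.convex_ergodicCapacity hμ hμ' x.2 y.2 hxy', (x : ℝ) • σ + (y : ℝ) • σ',
    fun J => hbox (hσ J) (hσ' J) x.2 y.2 hxy', fun k => ?_, fun I => ?_⟩
  · simp only [map_add, map_smul, smul_eq_mul, Pi.add_apply, Pi.smul_apply, NNReal.coe_add,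
      NNReal.coe_mul]
    exact add_le_add (mul_le_mul_of_nonneg_left (huser k) x.2)
      (mul_le_mul_of_nonneg_left (huser' k) y.2)
  · simp only [map_add, map_smul, smul_eq_mul, Pi.add_apply, Pi.smul_apply, mul_add,
      mul_left_comm sys.Tslot]
    exact add_le_add (mul_le_mul_of_nonneg_left (hload I) x.2)
      (mul_le_mul_of_nonneg_left (hload' I) y.2)

lemma exists_const_mem_Γcc : ∃ δ : ℝ≥0, 0 < δ ∧ (fun _ => δ) ∈ sys.Γcc := by
  obtain ⟨c, hc, hc0⟩ : ∃ c : ℝ, (∀ s, (fun _ => c) ∈ capacityRegion sys.P (sys.gain s)) ∧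
      0 < c :=
    ((eventually_all.2 fun s => eventually_const_mem_capacityRegion sys.P_pos
      (sys.gain_pos s)).and self_mem_nhdsWithin).exists
  have hσmax : (0 : ℝ) < sys.σmax := by exact_mod_cast sys.σmax_pos
  have hsmall : ∀ᶠ η : ℝ in 𝓝[>] 0,
      η ≤ sys.σmax ∧ ∀ I, sys.load I (fun _ => η) ≤ sys.Tslot * c := by
    refine nhdsWithin_le_nhds ((eventually_le_nhds hσmax).and (eventually_all.2 fun I => ?_))
    have hcont : Continuous fun η : ℝ => sys.load I fun _ => η :=
      (sys.load I).continuous_of_finiteDimensional.comp (continuous_pi fun _ => continuous_id)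
    refine (hcont.tendsto 0).eventually (Iic_mem_nhds ?_)
    exact (map_zero (sys.load I)).trans_lt (mul_pos sys.Tslot_pos hc0)
  obtain ⟨η, ⟨hησ, hload⟩, hη : 0 < η⟩ := (hsmall.and self_mem_nhdsWithin).exists
  refine ⟨η.toNNReal, Real.toNNReal_pos.2 hη, sys.mem_Γcc_iff.2 ⟨fun _ => c, ⟨fun _ _ => c, hc, ?_⟩,
    fun _ => η, fun _ => ⟨hη.le, hησ⟩, fun k => ?_, hload⟩⟩
  · ext J
    simp [← Finset.sum_mul, sys.φ_sum]
  · rw [Real.coe_toNNReal _ hη.le]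
    exact le_userTotal (v := fun _ => η) (fun _ => hη.le) (Finset.mem_singleton_self k)
      (J := ⟨{k}, Finset.singleton_nonempty k⟩)

theorem smul_mem_interior_Γcc {a : Fin K → ℝ≥0} (ha : a ∈ sys.Γcc) {x y : ℝ≥0} (hy : 0 < y)
    (hxy : x + y = 1) : x • a ∈ interior sys.Γcc := by
  obtain ⟨δ, hδ, hδΓ⟩ := sys.exists_const_mem_Γcc
  have hcombo : x • a + y • (fun _ => δ) ∈ sys.Γcc :=
    sys.convex_Γcc ha hδΓ zero_le zero_le hxy
  have hopen : IsOpen {c : Fin K → ℝ≥0 | ∀ k, c k < x * a k + y * δ} := by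
    simp only [Set.ofPred_forall]
    exact isOpen_iInter_of_finite fun k => isOpen_lt (continuous_apply k) continuous_const
  exact interior_maximal (fun c hc => sys.mem_Γcc_of_le hcombo fun k => (hc k).le) hopen
    fun k => lt_add_of_pos_right _ (mul_pos hy hδ)

theorem closure_interior_Γcc : closure (interior sys.Γcc) = sys.Γcc := by
  refine (closure_minimal interior_subset sys.isClosed_Γcc).antisymm fun a ha => ?_
  have hlim : Tendsto (fun n : ℕ => (1 - 1 / ((n : ℝ≥0) + 1)) • a) atTop (𝓝 a) := by
    have hinv : Tendsto (fun n : ℕ => 1 / ((n : ℝ≥0) + 1)) atTop (𝓝 0) := by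
      rw [← NNReal.tendsto_coe]
      simpa using tendsto_one_div_add_atTop_nhds_zero_nat (𝕜 := ℝ)
    simpa using ((tendsto_const_nhds (x := (1 : ℝ≥0))).sub hinv).smul_const a
  refine mem_closure_of_tendsto hlim (Eventually.of_forall fun n => ?_)
  refine sys.smul_mem_interior_Γcc ha (y := 1 / ((n : ℝ≥0) + 1)) (by positivity)
    (tsub_add_cancel_of_le ?_)
  rw [div_le_one (by positivity)]
  exact le_add_self

theorem exists_slack_of_mem_interior {a : Fin K → ℝ≥0} (ha : a ∈ interior sys.Γcc) :
    ∃ μ ∈ sys.ergodicCapacity, ∃ σ : UserGroup K → ℝ,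
      (∀ J, 0 ≤ σ J ∧ σ J ≤ sys.σmax) ∧ (∀ k, (a k : ℝ) ≤ userTotal k σ) ∧
      ∀ I, sys.load I σ = 0 ∨ sys.load I σ < sys.Tslot * μ I := by
  obtain ⟨δ, hδΓ, hδ : 1 < δ⟩ : ∃ δ : ℝ≥0, δ • a ∈ sys.Γcc ∧ 1 < δ := by
    have hcont : Continuous fun δ : ℝ≥0 => δ • a := by fun_prop
    have hnear : ∀ᶠ δ in 𝓝 (1 : ℝ≥0), δ • a ∈ interior sys.Γcc :=
      (hcont.tendsto 1).eventually (isOpen_interior.mem_nhds (by rwa [one_smul]))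
    exact (((hnear.mono fun _ h => interior_subset h).filter_mono nhdsWithin_le_nhds).and
      (self_mem_nhdsWithin (s := Set.Ioi 1))).exists
  obtain ⟨μ, hμ, σ, hσ, huser, hload⟩ := sys.mem_Γcc_iff.1 hδΓ
  have hδ' : (1 : ℝ) < δ := by exact_mod_cast hδ
  have hδ0 : (0 : ℝ) < δ := one_pos.trans hδ'
  refine ⟨μ, hμ, (δ : ℝ)⁻¹ • σ, fun J => ⟨mul_nonneg (by positivity) (hσ J).1, ?_⟩, fun k => ?_,
    fun I => ?_⟩
  · exact (mul_le_of_le_one_left (hσ J).1 (inv_le_one_of_one_le₀ hδ'.le)).trans (hσ J).2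
  · rw [map_smul, smul_eq_mul, le_inv_mul_iff₀ hδ0]
    exact_mod_cast huser k
  · rw [map_smul, smul_eq_mul]
    rcases (sys.load_nonneg I fun J => (hσ J).1).eq_or_lt with h0 | hpos
    · exact Or.inl (by rw [← h0, mul_zero])
    · exact Or.inr ((mul_lt_of_lt_one_left hpos (inv_lt_one_of_one_lt₀ hδ')).trans_le (hload I))

end CachingSystem

lemma continuous_totalUtility {K : ℕ} {α d : Fin K → ℝ} (hd : ∀ k, 0 < d k) :
    Continuous (totalUtility α d) := by
  refine continuous_finsetSum _ fun k _ => ?_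
  unfold alphaFair
  split_ifs
  · exact Continuous.log (by fun_prop) fun r =>
      (add_pos_of_pos_of_nonneg one_pos (div_nonneg (r k).2 (hd k).le)).ne'
  · exact (Continuous.rpow_const (by fun_prop) fun r =>
      Or.inl (add_pos_of_pos_of_nonneg (hd k) (r k).2).ne').div_const _

section RegularSet

variable {X : Type*} [TopologicalSpace X] {Γ : Set X}

lemma diff_frontier_eq_interior {A : Set X} (hint : interior Γ ⊆ A) (hsub : A ⊆ Γ) :
    A \ frontier Γ = interior Γ :=
  ((Set.sdiff_subset_sdiff_left hsub).trans (self_sdiff_frontier Γ).subset).antisymm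
    (Set.subset_sdiff.2 ⟨hint, disjoint_interior_frontier⟩)

lemma closure_eq_of_interior_subset (hΓ : IsClosed Γ) (hreg : closure (interior Γ) = Γ)
    {A : Set X} (hint : interior Γ ⊆ A) (hsub : A ⊆ Γ) : closure A = Γ :=
  (closure_minimal hsub hΓ).antisymm (hreg.symm.subset.trans (closure_mono hint))

lemma isLUB_image_of_closure_eq {A : Set X} (hA : closure A = Γ) {u : X → ℝ}
    (hu : Continuous u) {r : X} (hr : r ∈ Γ) (hmax : IsMaxOn u Γ r) : IsLUB (u '' A) (u r) := by
  refine ⟨?_, fun c hc => ?_⟩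
  · rintro _ ⟨a, ha, rfl⟩
    exact hmax (hA ▸ subset_closure ha)
  · have hle : closure A ⊆ {x | u x ≤ c} :=
      closure_minimal (fun a ha => hc ⟨a, ha, rfl⟩) (isClosed_le hu continuous_const)
    exact hle (hA ▸ hr)

end RegularSet

/-! ### Queues -/

lemma sum_min_add_userBacklog (a c : ℕ → ℕ) (t : ℕ) :
    ∑ s ∈ Finset.range t, min (userBacklog a c s) (c s) + userBacklog a c t =
      ∑ s ∈ Finset.range t, a s := by
  induction t with
  | zero => rfl
  | succ t ih =>
    rw [Finset.sum_range_succ, Finset.sum_range_succ, userBacklog]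
    lia

lemma sum_le_sum_add_userBacklog (a c : ℕ → ℕ) (t : ℕ) :
    ∑ s ∈ Finset.range t, a s ≤ ∑ s ∈ Finset.range t, c s + userBacklog a c t := by
  rw [← sum_min_add_userBacklog a c]
  gcongr
  exact min_le_right _ _

section CodewordQueue

variable {arr srv : ℕ → ℝ}

lemma codewordBacklog_nonneg (ha : ∀ t, 0 ≤ arr t) (t : ℕ) : 0 ≤ codewordBacklog arr srv t := by
  cases t with
  | zero => exact le_rfl
  | succ t => exact add_nonneg (le_max_right _ _) (ha t)

lemma codewordBacklog_le_sum (ha : ∀ t, 0 ≤ arr t) (hs : ∀ t, 0 ≤ srv t) (t : ℕ) :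
    codewordBacklog arr srv t ≤ ∑ s ∈ Finset.range t, arr s := by
  induction t with
  | zero => rfl
  | succ t ih =>
    rw [Finset.sum_range_succ, codewordBacklog]
    gcongr
    exact (max_le (sub_le_self _ (hs t)) (codewordBacklog_nonneg ha t)).trans ih

lemma sum_sub_sum_le_codewordBacklog (t : ℕ) :
    ∑ s ∈ Finset.range t, arr s - ∑ s ∈ Finset.range t, srv s ≤ codewordBacklog arr srv t := by
  induction t with
  | zero => simp [codewordBacklog]
  | succ t ih =>
    rw [Finset.sum_range_succ, Finset.sum_range_succ, codewordBacklog]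
    linarith [le_max_left (codewordBacklog arr srv t - srv t) 0]

end CodewordQueue

section Measurability

variable {Ω : Type*} {mΩ : MeasurableSpace Ω} (t : ℕ)

lemma measurable_codewordBacklog {arr srv : ℕ → Ω → ℝ} (ha : ∀ s < t, Measurable (arr s))
    (hs : ∀ s < t, Measurable (srv s)) :
    Measurable fun ω => codewordBacklog (fun s => arr s ω) (fun s => srv s ω) t := by
  induction t with
  | zero => exact measurable_const
  | succ t ih =>
    have hprev := ih (fun s hst => ha s (by lia)) fun s hst => hs s (by lia)
    exact ((hprev.sub (hs t t.lt_succ_self)).max measurable_const).add (ha t t.lt_succ_self)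

lemma measurable_userBacklog {a c : ℕ → Ω → ℕ} (ha : ∀ s < t, Measurable (a s))
    (hc : ∀ s < t, Measurable (c s)) :
    Measurable fun ω => userBacklog (fun s => a s ω) (fun s => c s ω) t := by
  induction t with
  | zero => exact measurable_const
  | succ t ih =>
    have hprev := ih (fun s hst => ha s (by lia)) fun s hst => hc s (by lia)
    exact (hprev.sub (hc t t.lt_succ_self)).add (ha t t.lt_succ_self)

end Measurability

namespace CachingSystem.Scheme

variable {K : ℕ} {sys : CachingSystem K} (π : Scheme sys)

lemma measurable_a (t : ℕ) (k : Fin K) : Measurable fun ω => π.a t ω k :=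
  measurable_pi_iff.1 ((π.a_adapted t).mono (π.ℱ.le t) le_rfl) k

lemma measurable_σ (t : ℕ) (J : UserGroup K) : Measurable fun ω => π.σ t ω J :=
  measurable_pi_iff.1 ((π.σ_adapted t).mono (π.ℱ.le t) le_rfl) J

lemma measurable_x (t : ℕ) (k : Fin K) (J : UserGroup K) : Measurable fun ω => π.x t ω k J :=
  measurable_pi_iff.1 (measurable_pi_iff.1 ((π.x_adapted t).mono (π.ℱ.le t) le_rfl) k) J

lemma measurable_μ (t : ℕ) : Measurable (π.μ t) :=
  (π.μ_adapted t).mono (π.ℱ.le t) le_rfl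

lemma measurable_μ_apply (t : ℕ) (I : UserGroup K) : Measurable fun ω => π.μ t ω I :=
  measurable_pi_iff.1 (π.measurable_μ t) I

lemma measurable_h (t : ℕ) : Measurable (π.h t) :=
  (π.h_adapted t).mono (π.ℱ.le t) le_rfl

lemma measurable_arrivals (I : UserGroup K) (t : ℕ) : Measurable (π.arrivals I t) :=
  Finset.measurable_sum _ fun J _ =>
    measurable_const.mul (measurable_from_top.comp (π.measurable_σ t J))

lemma measurable_created (I : UserGroup K) (t : ℕ) : Measurable (π.created I t) :=
  Finset.measurable_sum _ fun s _ => π.measurable_arrivals I s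

lemma measurable_Q (I : UserGroup K) (t : ℕ) : Measurable (π.Q I t) :=
  measurable_codewordBacklog t (fun s _ => π.measurable_arrivals I s)
    fun s _ => measurable_const.mul (π.measurable_μ_apply s I)

lemma measurable_S (k : Fin K) (t : ℕ) : Measurable (π.S k t) :=
  measurable_userBacklog t (fun s _ => π.measurable_a s k)
    fun s _ => Finset.measurable_sum _ fun J _ => π.measurable_σ s J

lemma measurableSet_transmitted (I : UserGroup K) (s t : ℕ) :
    MeasurableSet {ω | π.Transmitted I s t ω} :=
  measurableSet_le (π.measurable_created I _)
    ((π.measurable_created I t).sub (π.measurable_Q I t))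

lemma x_le_σmax (t : ℕ) (ω : π.Ω) (k : Fin K) (J : UserGroup K) : π.x t ω k J ≤ sys.σmax := by
  have hx := π.x_le t ω k J
  have hσ := π.σ_le t ω J
  grind

lemma arrivals_eq_load (I : UserGroup K) (t : ℕ) (ω : π.Ω) :
    π.arrivals I t ω = sys.load I fun J => π.σ t ω J :=
  (sys.load_apply I _).symm

lemma arrivals_nonneg (I : UserGroup K) (t : ℕ) (ω : π.Ω) : 0 ≤ π.arrivals I t ω := by
  rw [arrivals_eq_load]
  exact sys.load_nonneg I fun J => Nat.cast_nonneg _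

lemma service_nonneg (I : UserGroup K) (t : ℕ) (ω : π.Ω) : 0 ≤ sys.Tslot * π.μ t ω I :=
  mul_nonneg sys.Tslot_pos.le ((π.μ_mem t ω).1 I)

lemma Q_nonneg (I : UserGroup K) (t : ℕ) (ω : π.Ω) : 0 ≤ π.Q I t ω :=
  codewordBacklog_nonneg (fun s => π.arrivals_nonneg I s ω) t

lemma sent_nonneg (I : UserGroup K) (t : ℕ) (ω : π.Ω) : 0 ≤ π.sent I t ω :=
  sub_nonneg.2 (codewordBacklog_le_sum (fun s => π.arrivals_nonneg I s ω)
    (fun s => π.service_nonneg I s ω) t)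

lemma sent_le (I : UserGroup K) (t : ℕ) (ω : π.Ω) :
    π.sent I t ω ≤ sys.Tslot * ∑ s ∈ Finset.range t, π.μ s ω I := by
  rw [Finset.mul_sum]
  exact sub_le_comm.1 (sum_sub_sum_le_codewordBacklog t)

open Classical in
lemma sum_transmitted_le (I : UserGroup K) (t : ℕ) (ω : π.Ω) :
    ∑ s ∈ Finset.range t with π.Transmitted I s t ω, π.arrivals I s ω ≤ π.sent I t ω := by
  rcases (Finset.filter (fun s => π.Transmitted I s t ω) (Finset.range t)).eq_empty_or_nonempty
    with hempty | hne
  · rw [hempty, Finset.sum_empty]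
    exact π.sent_nonneg I t ω
  · have hlast := Finset.max'_mem _ hne
    refine (Finset.sum_le_sum_of_subset_of_nonneg (fun s hs => ?_)
      fun s _ _ => π.arrivals_nonneg I s ω).trans (Finset.mem_filter.1 hlast).2
    exact Finset.mem_range_succ_iff.2 (Finset.le_max' _ s hs)

/-- Mean of the rates before slot `T`, averaged over the slots. -/
def meanRate (T : ℕ) : UserGroup K → ℝ :=
  (T : ℝ)⁻¹ • ∑ t ∈ Finset.range T, ∫ ω, π.μ t ω ∂π.prob

lemma meanRate_mem_ergodicCapacity {T : ℕ} (hT : 0 < T) :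
    π.meanRate T ∈ sys.ergodicCapacity :=
  sys.average_mem_ergodicCapacity hT fun t =>
    sys.integral_mem_ergodicCapacity (π.measurable_h t) (π.h_law t) (π.measurable_μ t) (π.μ_mem t)

lemma integrable_μ_apply (t : ℕ) (I : UserGroup K) : Integrable (fun ω => π.μ t ω I) π.prob :=
  (sys.integrable_rates (π.measurable_μ t) (π.μ_mem t)).eval I

lemma integrable_sum_service (T : ℕ) (I : UserGroup K) :
    Integrable (fun ω => sys.Tslot * ∑ t ∈ Finset.range T, π.μ t ω I) π.prob :=
  (integrable_finsetSum _ fun t _ => π.integrable_μ_apply t I).const_mul _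

lemma integral_sum_service {T : ℕ} (hT : 0 < T) (I : UserGroup K) :
    ∫ ω, sys.Tslot * ∑ t ∈ Finset.range T, π.μ t ω I ∂π.prob =
      T * (sys.Tslot * π.meanRate T I) := by
  have heval : ∀ t, ∫ ω, π.μ t ω I ∂π.prob = (∫ ω, π.μ t ω ∂π.prob) I := fun t =>
    (eval_integral (fun J => π.integrable_μ_apply t J) I).symm
  rw [integral_const_mul, integral_finsetSum _ fun t _ => π.integrable_μ_apply t I]
  simp only [heval, meanRate, Pi.smul_apply, Finset.sum_apply, smul_eq_mul]
  have : (T : ℝ) ≠ 0 := by positivity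
  field_simp

end CachingSystem.Scheme

lemma eventually_sub_le_integral {Ω : Type*} [MeasurableSpace Ω] {prob : Measure Ω}
    [IsProbabilityMeasure prob] {X : ℕ → Ω → ℝ} (hX : ∀ t, Integrable (X t) prob)
    (hX0 : ∀ t ω, 0 ≤ X t ω) {r : ℝ} (hr : 0 ≤ r)
    (hlim : ∀ᵐ ω ∂prob, ∀ ε : ℝ, 0 < ε → ∀ᶠ t in atTop, r - ε ≤ X t ω) {ε : ℝ} (hε : 0 < ε) :
    ∀ᶠ t in atTop, r - ε ≤ ∫ ω, X t ω ∂prob := by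
  have hint : ∀ t, Integrable (fun ω => min (X t ω) r) prob := fun t =>
    (hX t).inf (integrable_const r)
  have hmin : Tendsto (fun t => ∫ ω, min (X t ω) r ∂prob) atTop (𝓝 (∫ _, r ∂prob)) := by
    refine tendsto_integral_of_dominated_convergence (fun _ => r)
      (fun t => (hint t).aestronglyMeasurable) (integrable_const r)
      (fun t => ae_of_all _ fun ω => ?_) (hlim.mono fun ω hω => tendsto_order.2 ⟨?_, ?_⟩)
    · rw [Real.norm_of_nonneg (le_min (hX0 t ω) hr)]
      exact min_le_right _ _
    · exact fun a ha => (hω ((r - a) / 2) (by linarith)).mono fun t ht =>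
        lt_min (by linarith) ha
    · exact fun b hb => .of_forall fun t => (min_le_right _ _).trans_lt hb
  simp only [integral_const, probReal_univ, smul_eq_mul, one_mul] at hmin
  filter_upwards [hmin.eventually (lt_mem_nhds (sub_lt_self r hε))] with t ht
  exact ht.le.trans (integral_mono (hint t) (hX t) fun ω => min_le_left _ _)

/-! ### Regrouping of abandoned combinations -/

namespace CachingSystem

variable {K : ℕ} (sys : CachingSystem K)

lemma b_union {J U I : UserGroup K} (hUJ : U.1 ⊆ J.1) (hIU : I.1 ⊆ U.1) {A : Finset (Fin K)}
    (hA : A ⊆ J.1 \ U.1) :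
    sys.b J ⟨I.1 ∪ A, I.2.mono Finset.subset_union_left⟩ =
      sys.b U I * (sys.m ^ A.card * (1 - sys.m) ^ ((J.1 \ U.1).card - A.card)) := by
  have hdisj : Disjoint I.1 A :=
    Finset.disjoint_of_subset_left hIU (Finset.disjoint_of_subset_right hA Finset.disjoint_sdiff)
  have hIcard := Finset.card_pos.2 I.2
  have hIUcard := Finset.card_le_card hIU
  have hAcard := Finset.card_le_card hA
  have hdiff := Finset.card_sdiff_add_card_eq_card hUJ
  have hexp : I.1.card + A.card - 1 = (I.1.card - 1) + A.card := by lia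
  have hexp' : J.1.card - (I.1.card + A.card) + 1 =
      (U.1.card - I.1.card + 1) + ((J.1 \ U.1).card - A.card) := by lia
  simp only [b, Finset.card_union_of_disjoint hdisj, hexp, hexp', pow_add]
  ring

/-- Each bit of the codeword for `I` that would be made if only the users of `U` were combined
is cached by a definite subset of `J \ U`, which tells the group `I'` to whose codeword it goes. -/
theorem sum_b_inter_eq {J U I : UserGroup K} (hUJ : U.1 ⊆ J.1) (hIU : I.1 ⊆ U.1) :
    ∑ I' : UserGroup K with I'.1 ⊆ J.1 ∧ U.1 ∩ I'.1 = I.1, sys.b J I' = sys.b U I := by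
  have hinv : ∀ I' : UserGroup K, U.1 ∩ I'.1 = I.1 →
      (⟨I.1 ∪ I'.1 \ U.1, I.2.mono Finset.subset_union_left⟩ : UserGroup K) = I' := by
    refine fun I' hI' => Subtype.ext ?_
    simp only [← hI', Finset.inter_comm U.1]
    exact sup_inf_sdiff I'.1 U.1
  calc ∑ I' : UserGroup K with I'.1 ⊆ J.1 ∧ U.1 ∩ I'.1 = I.1, sys.b J I'
      = ∑ A ∈ (J.1 \ U.1).powerset, sys.b U I *
          (sys.m ^ A.card * (1 - sys.m) ^ ((J.1 \ U.1).card - A.card)) := by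
        refine Finset.sum_bij' (fun I' _ => I'.1 \ U.1)
          (fun A _ => ⟨I.1 ∪ A, I.2.mono Finset.subset_union_left⟩) (by grind) (by grind)
          (fun I' hI' => hinv I' (Finset.mem_filter.1 hI').2.2) (by grind) fun I' hI' => ?_
        obtain ⟨hI'J, hI'U⟩ := (Finset.mem_filter.1 hI').2
        rw [← sys.b_union hUJ hIU (Finset.sdiff_subset_sdiff hI'J subset_rfl), hinv I' hI'U]
    _ = sys.b U I := by
        rw [← Finset.mul_sum, Finset.sum_pow_mul_eq_add_pow, add_sub_cancel, one_pow, mul_one]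

lemma sum_b_user_eq {U : UserGroup K} {k : Fin K} (hk : k ∈ U.1) :
    ∑ I : UserGroup K with I.1 ⊆ U.1 ∧ k ∈ I.1, sys.b U I = (1 - sys.m) * sys.F := by
  have hsingle := sys.sum_b_inter_eq (J := U) (U := ⟨{k}, by simp⟩) (I := ⟨{k}, by simp⟩)
    (by simpa using hk) subset_rfl
  simpa [b] using hsingle

lemma sum_sum_inter_eq (I' : UserGroup K) (g : UserGroup K → ℝ) :
    ∑ I : UserGroup K, ∑ U : UserGroup K with U.1 ∩ I'.1 = I.1, g U =
      ∑ U : UserGroup K with (U.1 ∩ I'.1).Nonempty, g U := by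
  simp only [Finset.sum_filter]
  rw [Finset.sum_comm]
  refine Finset.sum_congr rfl fun U _ => ?_
  split_ifs with hU
  · simpa [Subtype.ext_iff] using Finset.sum_ite_eq Finset.univ
      (⟨U.1 ∩ I'.1, hU⟩ : UserGroup K) fun _ => g U
  · exact Finset.sum_eq_zero fun I _ => if_neg fun h : U.1 ∩ I'.1 = I.1 =>
      hU (h ▸ I.2)

/-- `N J U` is the number of combinations for `J` out of which only the users of `U` are served.
These are the bits sent to the group `I'` that are turned into codewords for `I` when the other
users are dropped from the combinations. -/
def regroupedBits (N : UserGroup K → UserGroup K → ℝ) (I' I : UserGroup K) : ℝ :=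
  ∑ J : UserGroup K with I'.1 ⊆ J.1, ∑ U : UserGroup K with U.1 ∩ I'.1 = I.1,
    sys.b J I' * N J U

section RegroupedBits

variable {N : UserGroup K → UserGroup K → ℝ}

lemma regroupedBits_nonneg (hN : ∀ J U, 0 ≤ N J U) (I' I : UserGroup K) :
    0 ≤ sys.regroupedBits N I' I :=
  Finset.sum_nonneg fun J _ => Finset.sum_nonneg fun U _ => mul_nonneg (sys.b_nonneg J I') (hN J U)

lemma regroupedBits_eq_zero {I' I : UserGroup K} (hI : ¬ I.1 ⊆ I'.1) :
    sys.regroupedBits N I' I = 0 := by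
  refine Finset.sum_eq_zero fun J _ => Finset.sum_eq_zero fun U hU => ?_
  exact absurd ((Finset.mem_filter.1 hU).2 ▸ Finset.inter_subset_right) hI

lemma sum_regroupedBits (I' : UserGroup K) :
    ∑ I, sys.regroupedBits N I' I = ∑ J : UserGroup K with I'.1 ⊆ J.1,
      ∑ U : UserGroup K with (U.1 ∩ I'.1).Nonempty, sys.b J I' * N J U := by
  unfold regroupedBits
  rw [Finset.sum_comm]
  exact Finset.sum_congr rfl fun J _ => sum_sum_inter_eq I' _

lemma load_sum_eq_sum_regroupedBits (hsub : ∀ J U, ¬ U.1 ⊆ J.1 → N J U = 0) (I : UserGroup K) :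
    sys.load I (∑ J, N J) = ∑ I', sys.regroupedBits N I' I := by
  simp only [map_sum, regroupedBits]
  rw [Finset.sum_comm' (t' := Finset.univ) (s' := fun J => {I' : UserGroup K | I'.1 ⊆ J.1})
    (by simp)]
  refine Finset.sum_congr rfl fun J _ => ?_
  rw [Finset.sum_comm' (t' := {U : UserGroup K | I.1 ⊆ U.1})
    (s' := fun U => {I' : UserGroup K | I'.1 ⊆ J.1 ∧ U.1 ∩ I'.1 = I.1}) (by grind), load_apply]
  refine Finset.sum_congr rfl fun U hU => ?_
  by_cases hUJ : U.1 ⊆ J.1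
  · rw [← Finset.sum_mul, sys.sum_b_inter_eq hUJ (Finset.mem_filter.1 hU).2]
  · simp [hsub J U hUJ]

/-- The codewords sent to `I'` are split in proportion to the groups `I` they are turned into. -/
theorem exists_regrouped_rates {μ : UserGroup K → ℝ} (hμ : μ ∈ sys.ergodicCapacity)
    (hN : ∀ J U, 0 ≤ N J U) (hsub : ∀ J U, ¬ U.1 ⊆ J.1 → N J U = 0)
    (hserved : ∀ I, ∑ J : UserGroup K with I.1 ⊆ J.1,
      ∑ U : UserGroup K with (U.1 ∩ I.1).Nonempty, sys.b J I * N J U ≤ sys.Tslot * μ I) :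
    ∃ μ' ∈ sys.ergodicCapacity, ∀ I, sys.load I (∑ J, N J) ≤ sys.Tslot * μ' I := by
  have hTμ : ∀ I', 0 ≤ sys.Tslot * μ I' := fun I' =>
    mul_nonneg sys.Tslot_pos.le (sys.nonneg_of_mem_ergodicCapacity hμ I')
  have hbits := sys.regroupedBits_nonneg hN
  have hsum : ∀ I', ∑ I, sys.regroupedBits N I' I ≤ sys.Tslot * μ I' := fun I' =>
    (sys.sum_regroupedBits I').trans_le (hserved I')
  refine ⟨_, sys.reassign_to_subgroups_mem_ergodicCapacity hμ
    (w := fun I' I => sys.regroupedBits N I' I / (sys.Tslot * μ I'))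
    (fun I' I => div_nonneg (hbits I' I) (hTμ I'))
    (fun I' I hI => by rw [sys.regroupedBits_eq_zero hI, zero_div])
    (fun I' => by
      rw [← Finset.sum_div]
      exact div_le_one_of_le₀ (hsum I') (hTμ I')), fun I => ?_⟩
  rw [sys.load_sum_eq_sum_regroupedBits hsub, Finset.mul_sum]
  refine Finset.sum_le_sum fun I' _ => ?_
  rw [mul_left_comm]
  rcases (hTμ I').eq_or_lt with h0 | hpos
  · rw [← h0, mul_zero, h0]
    exact (Finset.single_le_sum (fun I _ => hbits I' I) (Finset.mem_univ I)).trans (hsum I')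
  · rw [div_mul_cancel₀ _ hpos.ne']

end RegroupedBits

lemma mean_logb_pos (k : Fin K) :
    0 < ∑ s, sys.φ s * Real.logb 2 (1 + sys.P * sys.gain s k) := by
  have hlog : ∀ s, 0 < Real.logb 2 (1 + sys.P * sys.gain s k) := fun s =>
    Real.logb_pos one_lt_two (lt_add_of_pos_right _ (mul_pos sys.P_pos (sys.gain_pos s k)))
  obtain ⟨s, hs⟩ : ∃ s, sys.φ s ≠ 0 := by
    by_contra! h
    simpa [h] using sys.φ_sum
  exact Finset.sum_pos' (fun s _ => mul_nonneg (sys.φ_nonneg s) (hlog s).le)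
    ⟨s, Finset.mem_univ s, mul_pos ((sys.φ_nonneg s).lt_of_ne' hs) (hlog s)⟩

/-- Serving a user of `U` takes `(1 - m) F` bits per combination for `U`, and a single user cannot
receive more than its point-to-point capacity. -/
theorem frequency_le_σmax
    (hcap : ∀ k, sys.Tslot * ∑ s, sys.φ s * Real.logb 2 (1 + sys.P * sys.gain s k) ≤
      (1 - sys.m) * sys.F * sys.σmax)
    {μ : UserGroup K → ℝ} (hμ : μ ∈ sys.ergodicCapacity) {σ : UserGroup K → ℝ}
    (hσ : ∀ U, 0 ≤ σ U) (hload : ∀ I, sys.load I σ ≤ sys.Tslot * μ I) (U : UserGroup K) :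
    σ U ≤ sys.σmax := by
  obtain ⟨k, hk⟩ := U.2
  have hfile : 0 < (1 - sys.m) * sys.F :=
    pos_of_mul_pos_left ((mul_pos sys.Tslot_pos (sys.mean_logb_pos k)).trans_le (hcap k))
      (Nat.cast_nonneg _)
  refine le_of_mul_le_mul_left ?_ hfile
  calc (1 - sys.m) * sys.F * σ U
      = ∑ I : UserGroup K with I.1 ⊆ U.1 ∧ k ∈ I.1, sys.b U I * σ U := by
        rw [← sys.sum_b_user_eq hk, Finset.sum_mul]
    _ ≤ ∑ I : UserGroup K with I.1 ⊆ U.1 ∧ k ∈ I.1, sys.load I σ := by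
        refine Finset.sum_le_sum fun I hI => ?_
        rw [load_apply]
        exact Finset.single_le_sum (f := fun V => sys.b V I * σ V)
          (fun V _ => mul_nonneg (sys.b_nonneg V I) (hσ V)) (by simp_all)
    _ ≤ userTotal k fun I => sys.load I σ := by
        rw [userTotal_apply]
        exact Finset.sum_le_sum_of_subset_of_nonneg
          (Finset.monotone_filter_right _ fun I _ hI => hI.2)
          fun I _ _ => sys.load_nonneg I hσ
    _ ≤ userTotal k (sys.Tslot • μ) := userTotal_le_userTotal k hload
    _ ≤ sys.Tslot * ∑ s, sys.φ s * Real.logb 2 (1 + sys.P * sys.gain s k) := by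
        rw [map_smul, smul_eq_mul]
        exact mul_le_mul_of_nonneg_left (sys.userTotal_le_of_mem_ergodicCapacity hμ k)
          sys.Tslot_pos.le
    _ ≤ (1 - sys.m) * sys.F * sys.σmax := hcap k

end CachingSystem

/-! ### Delivery rates -/

lemma eventually_sub_le_div_of_liminf_eq {D : ℕ → ℕ} {r : ℝ≥0}
    (h : liminf (fun t : ℕ => (D t : ℝ≥0∞) / (t : ℝ≥0∞)) atTop = (r : ℝ≥0∞)) {ε : ℝ}
    (hε : 0 < ε) : ∀ᶠ t : ℕ in atTop, (r : ℝ) - ε ≤ (D t : ℝ) / t := by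
  rcases lt_or_ge ((r : ℝ) - ε) 0 with hneg | hnonneg
  · exact Eventually.of_forall fun t => hneg.le.trans (by positivity)
  have hlt : ENNReal.ofReal ((r : ℝ) - ε) <
      liminf (fun t : ℕ => (D t : ℝ≥0∞) / (t : ℝ≥0∞)) atTop := by
    rw [h, ← ENNReal.ofReal_coe_nnreal, ENNReal.ofReal_lt_ofReal_iff_of_nonneg hnonneg]
    exact sub_lt_self _ hε
  filter_upwards [eventually_lt_of_lt_liminf hlt, eventually_gt_atTop 0] with t ht ht0
  rw [← ENNReal.ofReal_natCast, ← ENNReal.ofReal_natCast,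
    ← ENNReal.ofReal_div_of_pos (Nat.cast_pos.2 ht0),
    ENNReal.ofReal_lt_ofReal_iff_of_nonneg hnonneg] at ht
  exact ht.le

lemma sum_userGroup_ite_eq {K : ℕ} {A : Finset (Fin K)} {p : Finset (Fin K) → Prop}
    [DecidablePred p] (hp : p A → A.Nonempty) (c : ℝ) :
    ∑ V : UserGroup K with p V.1, (if A = V.1 then c else 0) = if p A then c else 0 := by
  rw [Finset.sum_filter]
  split_ifs with hA
  · rw [Finset.sum_eq_single ⟨A, hp hA⟩ (fun V _ hV => ?_) (by simp), if_pos hA, if_pos rfl]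
    rw [if_neg fun h : A = V.1 => hV (Subtype.ext h.symm), ite_self]
  · refine Finset.sum_eq_zero fun V _ => ?_
    split_ifs with hV hAV
    · exact absurd (hAV ▸ hV) hA
    all_goals rfl

namespace CachingSystem.Scheme

variable {K : ℕ} {sys : CachingSystem K} (π : Scheme sys)

/-- A rule that says which of the files combined before slot `t` count as delivered by then. It
covers both the delivered files and the files whose combinations have been carried through. -/
structure CreditRule (t : ℕ) where
  /-- the file of user `k` that was combined in slot `s` for the group `J` counts -/
  Credited : ℕ → UserGroup K → Fin K → π.Ω → Prop
  measurableSet_credited : ∀ s J k, MeasurableSet {ω | Credited s J k ω}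
  transmitted : ∀ {s J k ω}, Credited s J k ω → ∀ I : UserGroup K, k ∈ I.1 → I.1 ⊆ J.1 →
    π.Transmitted I s t ω

namespace CreditRule

variable {π} {t : ℕ} (C : π.CreditRule t)

open Classical in
/-- Users of `J` to whom the combinations made in slot `s` for `J` are credited. -/
def users (s : ℕ) (J : UserGroup K) (ω : π.Ω) : Finset (Fin K) :=
  {k ∈ J.1 | C.Credited s J k ω}

open Classical in
/-- Number of credited files of user `k`. -/
def files (k : Fin K) (ω : π.Ω) : ℕ :=
  ∑ s ∈ Finset.range t, ∑ J : UserGroup K, if C.Credited s J k ω then π.x s ω k J else 0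

/-- Number of combinations for the group `J` that are credited to exactly the users in `V`. -/
def count (J V : UserGroup K) (ω : π.Ω) : ℝ :=
  ∑ s ∈ Finset.range t, if C.users s J ω = V.1 then (π.σ s ω J : ℝ) else 0

/-- Mean number per slot of the combinations for `J` that are credited to exactly `V`. -/
def frequency (J V : UserGroup K) : ℝ :=
  (∫ ω, C.count J V ω ∂π.prob) / t

open Classical in
lemma users_subset (s : ℕ) (J : UserGroup K) (ω : π.Ω) : C.users s J ω ⊆ J.1 :=
  Finset.filter_subset _ _

open Classical in
lemma mem_users {s : ℕ} {J : UserGroup K} {ω : π.Ω} {k : Fin K} :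
    k ∈ C.users s J ω ↔ k ∈ J.1 ∧ C.Credited s J k ω :=
  Finset.mem_filter

lemma measurableSet_users_eq (s : ℕ) (J : UserGroup K) (V : Finset (Fin K)) :
    MeasurableSet {ω | C.users s J ω = V} := by
  simp only [Finset.ext_iff, mem_users, Set.ofPred_forall]
  exact MeasurableSet.iInter fun k => ((MeasurableSet.const (k ∈ J.1)).inter
    (C.measurableSet_credited s J k)).iff (MeasurableSet.const (k ∈ V))

lemma files_le (k : Fin K) (ω : π.Ω) :
    C.files k ω ≤ ∑ _s ∈ Finset.range t, ∑ _J : UserGroup K, sys.σmax := by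
  refine Finset.sum_le_sum fun s _ => Finset.sum_le_sum fun J _ => ?_
  split_ifs
  exacts [π.x_le_σmax s ω k J, Nat.zero_le _]

lemma integrable_files (k : Fin K) : Integrable (fun ω => (C.files k ω : ℝ)) π.prob := by
  have hmeas : Measurable (C.files k) :=
    Finset.measurable_sum _ fun s _ => Finset.measurable_sum _ fun J _ =>
      Measurable.ite (C.measurableSet_credited s J k) (π.measurable_x s k J) measurable_const
  refine Integrable.of_bound (measurable_from_top.comp hmeas).aestronglyMeasurable
    (∑ _s ∈ Finset.range t, ∑ _J : UserGroup K, sys.σmax : ℕ) (ae_of_all _ fun ω => ?_)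
  rw [Real.norm_of_nonneg (Nat.cast_nonneg _)]
  exact_mod_cast C.files_le k ω

lemma count_nonneg (J V : UserGroup K) (ω : π.Ω) : 0 ≤ C.count J V ω :=
  Finset.sum_nonneg fun s _ => by positivity

lemma count_le (J V : UserGroup K) (ω : π.Ω) : C.count J V ω ≤ t * sys.σmax := by
  calc C.count J V ω ≤ ∑ _s ∈ Finset.range t, (sys.σmax : ℝ) := by
        refine Finset.sum_le_sum fun s _ => ?_
        split_ifs
        · exact_mod_cast π.σ_le s ω J
        · positivity
    _ = t * sys.σmax := by simp

lemma integrable_count (J V : UserGroup K) : Integrable (C.count J V) π.prob := by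
  have hmeas : Measurable (C.count J V) :=
    Finset.measurable_sum _ fun s _ => Measurable.ite (C.measurableSet_users_eq s J V.1)
      (measurable_from_top.comp (π.measurable_σ s J)) measurable_const
  refine Integrable.of_bound (C := t * sys.σmax) hmeas.aestronglyMeasurable
    (ae_of_all _ fun ω => ?_)
  rw [Real.norm_of_nonneg (C.count_nonneg J V ω)]
  exact C.count_le J V ω

lemma frequency_nonneg (J V : UserGroup K) : 0 ≤ C.frequency J V :=
  div_nonneg (integral_nonneg (C.count_nonneg J V)) (Nat.cast_nonneg t)

lemma frequency_le (J V : UserGroup K) : C.frequency J V ≤ sys.σmax := by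
  refine div_le_of_le_mul₀ (Nat.cast_nonneg t) (Nat.cast_nonneg _) ?_
  refine (integral_mono (C.integrable_count J V) (integrable_const _) (C.count_le J V)).trans ?_
  simp [mul_comm]

lemma frequency_eq_zero {J V : UserGroup K} (h : ∀ s ω, C.users s J ω ≠ V.1) :
    C.frequency J V = 0 := by
  have hcount : C.count J V = 0 := by
    ext ω
    exact Finset.sum_eq_zero fun s _ => if_neg (h s ω)
  simp [frequency, hcount]

lemma files_le_userTotal (k : Fin K) (ω : π.Ω) :
    (C.files k ω : ℝ) ≤ userTotal k fun V => ∑ J, C.count J V ω := by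
  calc (C.files k ω : ℝ)
      ≤ ∑ s ∈ Finset.range t, ∑ J : UserGroup K,
          if k ∈ C.users s J ω then (π.σ s ω J : ℝ) else 0 := by
        rw [files]
        push_cast
        refine Finset.sum_le_sum fun s _ => Finset.sum_le_sum fun J _ => ?_
        have hx : (π.x s ω k J : ℝ) ≤ if k ∈ J.1 then (π.σ s ω J : ℝ) else 0 := by
          exact_mod_cast π.x_le s ω k J
        split_ifs at hx ⊢ <;> simp_all [C.mem_users]
    _ = userTotal k fun V => ∑ J, C.count J V ω := by
        simp only [← sum_userGroup_ite_eq (p := fun A => k ∈ A) fun hk => ⟨k, hk⟩,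
          userTotal_apply, count]
        rw [Finset.sum_comm_cycle]
        exact Finset.sum_congr rfl fun V _ => Finset.sum_comm

lemma mean_files_le_userTotal (k : Fin K) :
    ∫ ω, (C.files k ω : ℝ) / t ∂π.prob ≤ userTotal k (∑ J, C.frequency J) := by
  have hint := fun V => integrable_finsetSum Finset.univ fun J _ => C.integrable_count J V
  have hmean : ∫ ω, (C.files k ω : ℝ) ∂π.prob ≤
      ∫ ω, userTotal k (fun V => ∑ J, C.count J V ω) ∂π.prob := by
    refine integral_mono (C.integrable_files k) ?_ (C.files_le_userTotal k)
    simp only [userTotal_apply]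
    exact integrable_finsetSum _ fun V _ => hint V
  rw [integral_div]
  refine (div_le_div_of_nonneg_right hmean (Nat.cast_nonneg t)).trans_eq ?_
  simp only [userTotal_apply]
  rw [integral_finsetSum _ fun V _ => hint V]
  simp only [integral_finsetSum _ fun J _ => C.integrable_count J _, Finset.sum_div, frequency,
    Finset.sum_apply]

lemma sum_b_mul_count_le (I : UserGroup K) (ω : π.Ω) :
    ∑ J : UserGroup K with I.1 ⊆ J.1, ∑ V : UserGroup K with (V.1 ∩ I.1).Nonempty,
      sys.b J I * C.count J V ω ≤ π.sent I t ω := by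
  classical
  refine le_trans ?_ (π.sum_transmitted_le I t ω)
  simp only [count, Finset.mul_sum, Finset.sum_comm (t := Finset.range t)]
  rw [Finset.sum_filter (s := Finset.range t)]
  refine Finset.sum_le_sum fun s _ => ?_
  have hslot : ∀ J : UserGroup K, I.1 ⊆ J.1 →
      ∑ V : UserGroup K with (V.1 ∩ I.1).Nonempty,
        sys.b J I * (if C.users s J ω = V.1 then (π.σ s ω J : ℝ) else 0) ≤
      if π.Transmitted I s t ω then sys.b J I * π.σ s ω J else 0 := by
    intro J hIJ
    have hnonneg := mul_nonneg (sys.b_nonneg J I) (π.σ s ω J).cast_nonneg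
    rw [← Finset.mul_sum, sum_userGroup_ite_eq (p := fun A => (A ∩ I.1).Nonempty)
      fun h => h.mono Finset.inter_subset_left]
    split_ifs with hserved htransmitted htransmitted
    · exact le_rfl
    · obtain ⟨k, hk⟩ := hserved
      obtain ⟨hkC, hkI⟩ := Finset.mem_inter.1 hk
      exact absurd (C.transmitted (C.mem_users.1 hkC).2 I hkI hIJ) htransmitted
    · simpa using hnonneg
    · simp
  refine (Finset.sum_le_sum fun J hJ => hslot J (Finset.mem_filter.1 hJ).2).trans_eq ?_
  split_ifs <;> simp [arrivals]

lemma sum_b_mul_frequency_le (ht : 0 < t) (I : UserGroup K) :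
    ∑ J : UserGroup K with I.1 ⊆ J.1, ∑ V : UserGroup K with (V.1 ∩ I.1).Nonempty,
      sys.b J I * C.frequency J V ≤ sys.Tslot * π.meanRate t I := by
  have hint := fun J => integrable_finsetSum {V : UserGroup K | (V.1 ∩ I.1).Nonempty}
    fun V _ => (C.integrable_count J V).const_mul (sys.b J I)
  have hmean := integral_mono (integrable_finsetSum _ fun J _ => hint J)
    (π.integrable_sum_service t I)
    fun ω => (C.sum_b_mul_count_le I ω).trans (π.sent_le I t ω)
  rw [π.integral_sum_service ht, integral_finsetSum _ fun J _ => hint J] at hmean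
  simp only [integral_finsetSum _ fun V _ => (C.integrable_count _ V).const_mul _,
    integral_const_mul] at hmean
  rw [mul_comm, ← div_le_iff₀ (Nat.cast_pos.2 ht), Finset.sum_div] at hmean
  simpa only [frequency, Finset.sum_div, mul_div_assoc] using hmean

theorem exists_rates (ht : 0 < t) :
    ∃ μ ∈ sys.ergodicCapacity, ∀ I, sys.load I (∑ J, C.frequency J) ≤ sys.Tslot * μ I :=
  sys.exists_regrouped_rates (π.meanRate_mem_ergodicCapacity ht) C.frequency_nonneg
    (fun J _ hVJ => C.frequency_eq_zero fun s ω h => hVJ (h ▸ C.users_subset s J ω))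
    (C.sum_b_mul_frequency_le ht)

lemma sum_frequency_nonneg (V : UserGroup K) : 0 ≤ (∑ J, C.frequency J) V := by
  rw [Finset.sum_apply]
  exact Finset.sum_nonneg fun J _ => C.frequency_nonneg J V

lemma sum_frequency_le_of_capacity
    (hcap : ∀ k, sys.Tslot * ∑ s, sys.φ s * Real.logb 2 (1 + sys.P * sys.gain s k) ≤
      (1 - sys.m) * sys.F * sys.σmax) (ht : 0 < t) (V : UserGroup K) :
    (∑ J, C.frequency J) V ≤ sys.σmax := by
  obtain ⟨μ, hμ, hload⟩ := C.exists_rates ht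
  exact sys.frequency_le_σmax hcap hμ C.sum_frequency_nonneg hload V

lemma sum_frequency_le_of_users (h : ∀ s J ω, C.users s J ω = J.1 ∨ C.users s J ω = ∅)
    (V : UserGroup K) : (∑ J, C.frequency J) V ≤ sys.σmax := by
  rw [Finset.sum_apply, Finset.sum_eq_single V (fun J _ hJ => C.frequency_eq_zero fun s ω hV => ?_)
    (by simp)]
  · exact C.frequency_le V V
  · rcases h s J ω with hJV | hempty
    · exact hJ (Subtype.ext (hJV.symm.trans hV))
    · exact V.2.ne_empty (hV.symm.trans hempty)

end CreditRule

theorem mem_Γcc_of_creditRule (C : ∀ t, π.CreditRule t)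
    (hσ : ∀ t, 0 < t → ∀ V, (∑ J, (C t).frequency J) V ≤ sys.σmax) {r : Fin K → ℝ≥0}
    (hrate : ∀ᵐ ω ∂π.prob, ∀ k, ∀ ε : ℝ, 0 < ε →
      ∀ᶠ t : ℕ in atTop, (r k : ℝ) - ε ≤ ((C t).files k ω : ℝ) / t) :
    r ∈ sys.Γcc := by
  refine sys.mem_Γcc_of_approx fun ε hε => ?_
  have hmean : ∀ᶠ t : ℕ in atTop, ∀ k, (r k : ℝ) - ε ≤ ∫ ω, ((C t).files k ω : ℝ) / t ∂π.prob :=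
    eventually_all.2 fun k => eventually_sub_le_integral
      (fun t => ((C t).integrable_files k).div_const _) (fun t ω => by positivity) (r k).2
      (hrate.mono fun ω h => h k) hε
  obtain ⟨t, hfiles, ht⟩ := (hmean.and (eventually_gt_atTop 0)).exists
  obtain ⟨μ, hμ, hload⟩ := (C t).exists_rates ht
  exact ⟨μ, hμ, ∑ J, (C t).frequency J,
    fun V => ⟨(C t).sum_frequency_nonneg V, hσ t ht V⟩,
    fun k => (hfiles k).trans ((C t).mean_files_le_userTotal k),
    fun I => (sub_le_self _ hε.le).trans (hload I)⟩

/-- The rule that counts the delivered files. -/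
def deliveredRule (t : ℕ) : π.CreditRule t where
  Credited s J k ω := ∀ I : UserGroup K, k ∈ I.1 → I.1 ⊆ J.1 → π.Transmitted I s t ω
  measurableSet_credited s J k := by
    simp only [Set.ofPred_forall]
    exact MeasurableSet.iInter fun I => MeasurableSet.iInter fun _ => MeasurableSet.iInter
      fun _ => π.measurableSet_transmitted I s t
  transmitted h := h

/-- The rule that counts the files whose combinations have been carried through. -/
def carriedThroughRule (t : ℕ) : π.CreditRule t where
  Credited s J _ ω := ∀ I : UserGroup K, I.1 ⊆ J.1 → π.Transmitted I s t ω
  measurableSet_credited s J _ := by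
    simp only [Set.ofPred_forall]
    exact MeasurableSet.iInter fun I => MeasurableSet.iInter
      fun _ => π.measurableSet_transmitted I s t
  transmitted h I _ := h I

open Classical in
lemma users_carriedThroughRule (t s : ℕ) (J : UserGroup K) (ω : π.Ω) :
    (π.carriedThroughRule t).users s J ω = J.1 ∨ (π.carriedThroughRule t).users s J ω = ∅ := by
  by_cases h : ∀ I : UserGroup K, I.1 ⊆ J.1 → π.Transmitted I s t ω
  · exact Or.inl (Finset.filter_true_of_mem fun _ _ => h)
  · exact Or.inr (Finset.filter_false_of_mem fun _ _ => h)

open Classical in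
lemma files_deliveredRule (k : Fin K) (t : ℕ) :
    (π.deliveredRule t).files k = π.delivered k t := by
  funext ω
  refine Finset.sum_congr rfl fun s _ => Finset.sum_congr rfl fun J _ => ?_
  exact if_congr Iff.rfl rfl rfl

open Classical in
lemma files_carriedThroughRule (k : Fin K) (t : ℕ) :
    (π.carriedThroughRule t).files k = π.carriedThrough k t := by
  funext ω
  refine Finset.sum_congr rfl fun s _ => Finset.sum_congr rfl fun J _ => ?_
  exact if_congr Iff.rfl rfl rfl

end CachingSystem.Scheme

namespace CachingSystem

variable {K : ℕ} (sys : CachingSystem K)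

theorem Λcc_subset_Γcc : sys.Λcc ⊆ sys.Γcc := by
  rintro r ⟨π, hirrevocable, hdelivered⟩
  refine π.mem_Γcc_of_creditRule π.carriedThroughRule
    (fun t _ => (π.carriedThroughRule t).sum_frequency_le_of_users
      (π.users_carriedThroughRule t)) ?_
  filter_upwards [hirrevocable, hdelivered] with ω hlost hrate k ε hε
  filter_upwards [eventually_sub_le_div_of_liminf_eq (hrate k) (half_pos hε),
    (hlost k).eventually (gt_mem_nhds (half_pos hε))] with t hdel hdiff
  rw [sub_div] at hdiff
  rw [Scheme.files_carriedThroughRule]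
  linarith

theorem ΛccRevocable_subset_Γcc
    (hcap : ∀ k, sys.Tslot * ∑ s, sys.φ s * Real.logb 2 (1 + sys.P * sys.gain s k) ≤
      (1 - sys.m) * sys.F * sys.σmax) : sys.ΛccRevocable ⊆ sys.Γcc := by
  rintro r ⟨π, hdelivered⟩
  refine π.mem_Γcc_of_creditRule π.deliveredRule
    (fun t ht => (π.deliveredRule t).sum_frequency_le_of_capacity hcap ht) ?_
  filter_upwards [hdelivered] with ω hrate k ε hε
  simpa only [Scheme.files_deliveredRule] using eventually_sub_le_div_of_liminf_eq (hrate k) hε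

end CachingSystem

/-! ### Admission rates of strongly stable schemes -/

lemma frequently_lt_of_eventually_average_lt {g : ℕ → ℝ≥0∞} {c : ℝ≥0∞}
    (h : ∀ᶠ T : ℕ in atTop, (∑ t ∈ Finset.range T, g t) / (T : ℝ≥0∞) < c) :
    ∃ᶠ t in atTop, g t < 2 * c := by
  refine frequently_atTop.2 fun n => ?_
  by_contra! hlarge
  obtain ⟨T₀, hT₀⟩ := eventually_atTop.1 h
  set p := max T₀ (n + 1)
  have hsum := hT₀ (p + p) (by lia)
  rw [ENNReal.div_lt_iff (by simp; lia) (by simp)] at hsum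
  refine hsum.not_ge ?_
  calc c * ((p + p : ℕ) : ℝ≥0∞) = ∑ _t ∈ Finset.range p, 2 * c := by simp; ring
    _ ≤ ∑ t ∈ Finset.range p, g (p + t) := Finset.sum_le_sum fun t _ => hlarge (p + t) (by lia)
    _ ≤ ∑ t ∈ Finset.range (p + p), g t := by
        rw [Finset.sum_range_add]
        exact le_add_self

lemma exists_frequently_forall_le {ι : Type*} [Finite ι] {f : ι → ℕ → ℝ≥0∞}
    (hf : ∀ i, limsup (fun T : ℕ => (∑ t ∈ Finset.range T, f i t) / (T : ℝ≥0∞)) atTop < ⊤) :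
    ∃ M : ℝ≥0, ∃ᶠ t in atTop, ∀ i, f i t ≤ M := by
  have := Fintype.ofFinite ι
  choose B hlimsup _ using fun i => ENNReal.lt_iff_exists_nnreal_btwn.1 (hf i)
  have havg : ∀ᶠ T : ℕ in atTop,
      (∑ t ∈ Finset.range T, ∑ i, f i t) / (T : ℝ≥0∞) < ∑ i, (B i : ℝ≥0∞) + 1 := by
    filter_upwards [eventually_all.2 fun i => eventually_lt_of_limsup_lt (hlimsup i)] with T hT
    rw [Finset.sum_comm]
    simp only [div_eq_mul_inv, Finset.sum_mul] at hT ⊢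
    refine (Finset.sum_le_sum fun i _ => (hT i).le).trans_lt ?_
    exact_mod_cast lt_add_one (∑ i, B i)
  refine ⟨2 * (∑ i, B i + 1), (frequently_lt_of_eventually_average_lt havg).mono fun t ht i => ?_⟩
  push_cast
  exact (Finset.single_le_sum (f := fun i => f i t) (fun _ _ => zero_le) (Finset.mem_univ i)).trans
    ht.le

namespace CachingSystem.Scheme

variable {K : ℕ} {sys : CachingSystem K} (π : Scheme sys)

/-- Numbers of combinations made before slot `T`. -/
def combinations (T : ℕ) (ω : π.Ω) : UserGroup K → ℝ :=
  ∑ t ∈ Finset.range T, fun J => (π.σ t ω J : ℝ)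

/-- Mean numbers of combinations made per slot before slot `T`. -/
def meanCombinations (T : ℕ) : UserGroup K → ℝ :=
  (T : ℝ)⁻¹ • ∫ ω, π.combinations T ω ∂π.prob

lemma combinations_nonneg (T : ℕ) (ω : π.Ω) : 0 ≤ π.combinations T ω :=
  Finset.sum_nonneg fun t _ J => Nat.cast_nonneg (π.σ t ω J)

lemma combinations_le (T : ℕ) (ω : π.Ω) (J : UserGroup K) :
    π.combinations T ω J ≤ T * sys.σmax := by
  rw [combinations, Finset.sum_apply]
  refine (Finset.sum_le_sum fun t _ => Nat.cast_le.2 (π.σ_le t ω J)).trans_eq ?_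
  simp

lemma integrable_combinations (T : ℕ) : Integrable (π.combinations T) π.prob := by
  have hmeas : Measurable (π.combinations T) :=
    Finset.measurable_sum _ fun t _ =>
      measurable_pi_iff.2 fun J => measurable_from_top.comp (π.measurable_σ t J)
  refine Integrable.of_bound (C := T * sys.σmax) hmeas.aestronglyMeasurable
    (ae_of_all _ fun ω => (pi_norm_le_iff_of_nonneg (by positivity)).2 fun J => ?_)
  rw [Real.norm_of_nonneg (π.combinations_nonneg T ω J)]
  exact π.combinations_le T ω J

lemma integrable_map_combinations (T : ℕ) (L : (UserGroup K → ℝ) →ₗ[ℝ] ℝ) :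
    Integrable (fun ω => L (π.combinations T ω)) π.prob :=
  L.toContinuousLinearMap.integrable_comp (π.integrable_combinations T)

lemma integral_map_combinations {T : ℕ} (hT : 0 < T) (L : (UserGroup K → ℝ) →ₗ[ℝ] ℝ) :
    ∫ ω, L (π.combinations T ω) ∂π.prob = T * L (π.meanCombinations T) := by
  have hT' : (T : ℝ) ≠ 0 := by positivity
  rw [meanCombinations, map_smul, smul_eq_mul, mul_inv_cancel_left₀ hT']
  exact L.toContinuousLinearMap.integral_comp_comm (π.integrable_combinations T)

lemma meanCombinations_mem_box {T : ℕ} (hT : 0 < T) (J : UserGroup K) :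
    0 ≤ π.meanCombinations T J ∧ π.meanCombinations T J ≤ sys.σmax := by
  have hT' : (0 : ℝ) < T := Nat.cast_pos.2 hT
  have hmean : π.meanCombinations T J = (∫ ω, π.combinations T ω J ∂π.prob) / T := by
    rw [eq_div_iff hT'.ne', mul_comm]
    exact (π.integral_map_combinations hT (LinearMap.proj J)).symm
  rw [hmean, div_le_iff₀ hT']
  refine ⟨div_nonneg (integral_nonneg fun ω => π.combinations_nonneg T ω J) hT'.le, ?_⟩
  simpa [mul_comm] using integral_mono (π.integrable_map_combinations T (LinearMap.proj J))
    (integrable_const _) fun ω => π.combinations_le T ω J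

lemma created_eq_load (I : UserGroup K) (T : ℕ) (ω : π.Ω) :
    π.created I T ω = sys.load I (π.combinations T ω) := by
  simp only [created, combinations, map_sum, arrivals_eq_load]

lemma sum_a_le_userTotal_add_S (k : Fin K) (T : ℕ) (ω : π.Ω) :
    ∑ t ∈ Finset.range T, (π.a t ω k : ℝ≥0∞) ≤
      ENNReal.ofReal (userTotal k (π.combinations T ω)) + π.S k T ω := by
  have hcombined : userTotal k (π.combinations T ω) =
      ∑ t ∈ Finset.range T, ∑ J : UserGroup K with k ∈ J.1, π.σ t ω J := by
    simp only [combinations, map_sum, userTotal_natCast, Nat.cast_sum]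
  rw [hcombined, ENNReal.ofReal_natCast]
  exact_mod_cast sum_le_sum_add_userBacklog (fun t => π.a t ω k)
    (fun t => ∑ J : UserGroup K with k ∈ J.1, π.σ t ω J) T

lemma sum_lintegral_a_le {T : ℕ} (hT : 0 < T) (k : Fin K) :
    ∑ t ∈ Finset.range T, ∫⁻ ω, (π.a t ω k : ℝ≥0∞) ∂π.prob ≤
      ENNReal.ofReal (T * userTotal k (π.meanCombinations T)) +
        ∫⁻ ω, (π.S k T ω : ℝ≥0∞) ∂π.prob := by
  have hS : Measurable fun ω => (π.S k T ω : ℝ≥0∞) :=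
    measurable_from_top.comp (π.measurable_S k T)
  have ha : ∀ t, Measurable fun ω => (π.a t ω k : ℝ≥0∞) := fun t =>
    measurable_from_top.comp (π.measurable_a t k)
  have hcombined : ∀ ω, 0 ≤ userTotal k (π.combinations T ω) := fun ω => by
    simpa using userTotal_le_userTotal k (v := 0) (π.combinations_nonneg T ω)
  rw [← π.integral_map_combinations hT, ofReal_integral_eq_lintegral_ofReal
    (π.integrable_map_combinations T _) (ae_of_all _ hcombined), ← lintegral_add_right _ hS,
    ← lintegral_finsetSum _ fun t _ => ha t]
  exact lintegral_mono fun ω => π.sum_a_le_userTotal_add_S k T ω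

lemma integrable_Q (I : UserGroup K) (T : ℕ) : Integrable (π.Q I T) π.prob := by
  refine (π.integrable_map_combinations T (sys.load I)).mono'
    (π.measurable_Q I T).aestronglyMeasurable (ae_of_all _ fun ω => ?_)
  rw [Real.norm_of_nonneg (π.Q_nonneg I T ω), ← created_eq_load]
  exact sub_nonneg.1 (π.sent_nonneg I T ω)

lemma load_meanCombinations_le {T : ℕ} (hT : 0 < T) (I : UserGroup K) :
    T * sys.load I (π.meanCombinations T) ≤
      T * (sys.Tslot * π.meanRate T I) + ∫ ω, π.Q I T ω ∂π.prob := by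
  rw [← π.integral_map_combinations hT, ← π.integral_sum_service hT,
    ← integral_add (π.integrable_sum_service T I) (π.integrable_Q I T)]
  refine integral_mono (π.integrable_map_combinations T _)
    ((π.integrable_sum_service T I).add (π.integrable_Q I T)) fun ω => ?_
  rw [← created_eq_load]
  exact sub_le_iff_le_add.1 (π.sent_le I T ω)

lemma integral_Q_le_of_lintegral_le {I : UserGroup K} {T : ℕ} {M : ℝ≥0}
    (h : ∫⁻ ω, ENNReal.ofReal (π.Q I T ω) ∂π.prob ≤ M) : ∫ ω, π.Q I T ω ∂π.prob ≤ M := by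
  rw [integral_eq_lintegral_of_nonneg_ae (ae_of_all _ fun ω => π.Q_nonneg I T ω)
    (π.measurable_Q I T).aestronglyMeasurable]
  exact ENNReal.toReal_le_coe_of_le_coe h

variable {π}

lemma HasAdmissionRate.eventually_sub_lt {a : Fin K → ℝ≥0} (h : π.HasAdmissionRate a) {ε : ℝ}
    (hε : 0 < ε) : ∀ᶠ T : ℕ in atTop, ∀ k, (a k : ℝ) - ε <
      (∑ t ∈ Finset.range T, ∫⁻ ω, (π.a t ω k : ℝ≥0∞) ∂π.prob).toReal / T := by
  refine eventually_all.2 fun k => ?_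
  filter_upwards [((ENNReal.tendsto_toReal ENNReal.coe_ne_top).comp (h k)).eventually
    (lt_mem_nhds (sub_lt_self _ hε))] with T hT
  rwa [Function.comp_apply, ENNReal.toReal_div, ENNReal.toReal_natCast] at hT

lemma Stable.exists_frequently_le (h : π.Stable) :
    ∃ M : ℝ≥0, ∃ᶠ T in atTop, (∀ k, ∫⁻ ω, (π.S k T ω : ℝ≥0∞) ∂π.prob ≤ M) ∧
      ∀ I, ∫⁻ ω, ENNReal.ofReal (π.Q I T ω) ∂π.prob ≤ M := by
  obtain ⟨M, hM⟩ := exists_frequently_forall_le (ι := Fin K ⊕ UserGroup K)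
    (f := Sum.elim (fun k t => ∫⁻ ω, (π.S k t ω : ℝ≥0∞) ∂π.prob)
      fun I t => ∫⁻ ω, ENNReal.ofReal (π.Q I t ω) ∂π.prob) (Sum.rec h.1 h.2)
  exact ⟨M, hM.mono fun T hT => Sum.forall.1 hT⟩

end CachingSystem.Scheme

theorem CachingSystem.stabilityRegion_subset_Γcc {K : ℕ} (sys : CachingSystem K) :
    sys.stabilityRegion ⊆ sys.Γcc := by
  rintro a ⟨π, hadmission, hstable⟩
  refine sys.mem_Γcc_of_approx fun ε hε => ?_
  obtain ⟨M, hM⟩ := hstable.exists_frequently_le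
  have hsmall : ∀ᶠ T : ℕ in atTop, (M : ℝ) / T < ε / 2 :=
    (tendsto_const_div_atTop_nhds_zero_nat (M : ℝ)).eventually (gt_mem_nhds (half_pos hε))
  obtain ⟨T, ⟨hS, hQ⟩, ha, hMT, hT⟩ := (hM.and_eventually ((hadmission.eventually_sub_lt
    (half_pos hε)).and (hsmall.and (eventually_gt_atTop 0)))).exists
  have hT' : (0 : ℝ) < T := Nat.cast_pos.2 hT
  rw [div_lt_iff₀ hT'] at hMT
  refine ⟨π.meanRate T, π.meanRate_mem_ergodicCapacity hT, π.meanCombinations T,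
    π.meanCombinations_mem_box hT, fun k => ?_, fun I => ?_⟩
  · have hadmitted := ENNReal.toReal_mono (by finiteness)
      ((π.sum_lintegral_a_le hT k).trans (add_le_add_right (hS k) _))
    have hcombined : 0 ≤ userTotal k (π.meanCombinations T) := by
      simpa using userTotal_le_userTotal k (v := 0) fun J => (π.meanCombinations_mem_box hT J).1
    rw [ENNReal.toReal_add (by finiteness) (by finiteness), ENNReal.coe_toReal,
      ENNReal.toReal_ofReal (by positivity)] at hadmitted
    have hak := ha k
    rw [lt_div_iff₀ hT'] at hak
    refine le_of_mul_le_mul_right ?_ hT'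
    linarith
  · have hload := π.load_meanCombinations_le hT I
    have hQM := π.integral_Q_le_of_lintegral_le (hQ I)
    refine le_of_mul_le_mul_left ?_ hT'
    nlinarith

/-! ### Backlogs under slack -/

section AverageBounds

lemma exists_abs_sub_mul_le {W : ℕ → ℝ} {d : ℝ} (h : Tendsto (fun t : ℕ => W t / t) atTop (𝓝 d))
    {ε : ℝ} (hε : 0 < ε) : ∃ C, ∀ t : ℕ, |W t - d * t| ≤ ε * t + C := by
  have hsmall : ∀ᶠ t : ℕ in atTop, |W t - d * t| - ε * t ≤ 0 := by
    filter_upwards [Metric.tendsto_nhds.1 h ε hε, eventually_gt_atTop 0] with t ht ht0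
    have htpos : (0 : ℝ) < t := Nat.cast_pos.2 ht0
    rw [Real.dist_eq, ← mul_lt_mul_iff_left₀ htpos, ← abs_of_pos htpos, ← abs_mul, sub_mul,
      abs_of_pos htpos, div_mul_cancel₀ _ htpos.ne'] at ht
    exact sub_nonpos.2 ht.le
  obtain ⟨C, hC⟩ := (isBoundedUnder_of_eventually_le hsmall).bddAbove_range
  exact ⟨C, fun t => sub_le_iff_le_add'.1 (hC ⟨t, rfl⟩)⟩

lemma tendsto_div_natCast_zero {q : ℕ → ℝ} (hq : ∀ t, 0 ≤ q t)
    (h : ∀ ε : ℝ, 0 < ε → ∃ C, ∀ t : ℕ, q t ≤ ε * t + C) :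
    Tendsto (fun t : ℕ => q t / t) atTop (𝓝 0) := by
  refine tendsto_order.2 ⟨fun a ha => .of_forall fun t =>
    ha.trans_le (div_nonneg (hq t) t.cast_nonneg), fun ε hε => ?_⟩
  obtain ⟨C, hC⟩ := h (ε / 2) (half_pos hε)
  filter_upwards [(tendsto_const_div_atTop_nhds_zero_nat C).eventually
    (gt_mem_nhds (half_pos hε)), eventually_gt_atTop 0] with t ht ht0
  have htpos : (0 : ℝ) < t := Nat.cast_pos.2 ht0
  rw [div_lt_iff₀ htpos] at ht ⊢
  linarith [hC t]

end AverageBounds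

section CodewordQueue

variable {arr srv : ℕ → ℝ}

lemma exists_codewordBacklog_le_net_input {A : ℝ} (hA0 : 0 ≤ A) (hA : ∀ t, arr t ≤ A) (t : ℕ) :
    ∃ s ≤ t, codewordBacklog arr srv t ≤
      (∑ i ∈ Finset.range t, arr i - ∑ i ∈ Finset.range t, srv i) -
      (∑ i ∈ Finset.range s, arr i - ∑ i ∈ Finset.range s, srv i) + A := by
  induction t with
  | zero => exact ⟨0, le_rfl, by simpa [codewordBacklog] using hA0⟩
  | succ t ih =>
    obtain ⟨s, hst, hs⟩ := ih
    rw [codewordBacklog]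
    rcases le_total (codewordBacklog arr srv t - srv t) 0 with hempty | hbusy
    · refine ⟨t + 1, le_rfl, ?_⟩
      rw [max_eq_right hempty]
      linarith [hA t]
    · refine ⟨s, by lia, ?_⟩
      rw [max_eq_left hbusy, Finset.sum_range_succ, Finset.sum_range_succ]
      linarith

theorem tendsto_codewordBacklog_div {A l c : ℝ} (ha : ∀ t, 0 ≤ arr t) (hA : ∀ t, arr t ≤ A)
    (hlc : l ≤ c) (harr : Tendsto (fun t : ℕ => (∑ s ∈ Finset.range t, arr s) / t) atTop (𝓝 l))
    (hsrv : Tendsto (fun t : ℕ => (∑ s ∈ Finset.range t, srv s) / t) atTop (𝓝 c)) :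
    Tendsto (fun t : ℕ => codewordBacklog arr srv t / t) atTop (𝓝 0) := by
  set W : ℕ → ℝ := fun t => ∑ s ∈ Finset.range t, arr s - ∑ s ∈ Finset.range t, srv s
  have hW : Tendsto (fun t : ℕ => W t / t) atTop (𝓝 (l - c)) := by
    simpa only [W, sub_div] using harr.sub hsrv
  refine tendsto_div_natCast_zero (codewordBacklog_nonneg ha) fun ε hε => ?_
  obtain ⟨C, hC⟩ := exists_abs_sub_mul_le hW (half_pos hε)
  refine ⟨2 * C + A, fun t => ?_⟩
  obtain ⟨s, hst, hs⟩ := exists_codewordBacklog_le_net_input (srv := srv) ((ha 0).trans (hA 0)) hA t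
  have hst' : (s : ℝ) ≤ t := Nat.cast_le.2 hst
  have hdrift : (l - c) * t ≤ (l - c) * s := mul_le_mul_of_nonpos_left hst' (sub_nonpos.2 hlc)
  have hεst : ε * s ≤ ε * t := mul_le_mul_of_nonneg_left hst' hε.le
  linarith [(abs_le.1 (hC t)).2, (abs_le.1 (hC s)).1]

lemma codewordBacklog_le_add_excess {l c : ℝ}
    (h : ∀ t : ℕ, l * t - c ≤ ∑ s ∈ Finset.range t, arr s) (t : ℕ) :
    codewordBacklog arr srv t ≤ codewordBacklog (fun _ => l) srv t +
      (∑ s ∈ Finset.range t, arr s - l * t + c) := by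
  induction t with
  | zero => simpa [codewordBacklog] using h 0
  | succ t ih =>
    have hexcess := h t
    have hserved : max (codewordBacklog arr srv t - srv t) 0 ≤
        max (codewordBacklog (fun _ => l) srv t - srv t) 0 +
          (∑ s ∈ Finset.range t, arr s - l * t + c) := by
      refine max_le ?_ (add_nonneg (le_max_right _ _) (by linarith))
      linarith [le_max_left (codewordBacklog (fun _ => l) srv t - srv t) 0]
    rw [codewordBacklog, codewordBacklog, Finset.sum_range_succ]
    push_cast
    linarith

end CodewordQueue

lemma cast_userBacklog (a c : ℕ → ℕ) (t : ℕ) :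
    (userBacklog a c t : ℝ) = codewordBacklog (fun s => (a s : ℝ)) (fun s => (c s : ℝ)) t := by
  induction t with
  | zero => simp [userBacklog, codewordBacklog]
  | succ t ih =>
    rw [userBacklog, codewordBacklog, ← ih, Nat.cast_add]
    congr 1
    rcases le_total (userBacklog a c t) (c t) with hempty | hbusy
    · rw [Nat.sub_eq_zero_of_le hempty, max_eq_right (sub_nonpos.2 (Nat.cast_le.2 hempty)),
        Nat.cast_zero]
    · rw [Nat.cast_sub hbusy, max_eq_left (sub_nonneg.2 (Nat.cast_le.2 hbusy))]

section ConstantInput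

variable {Ω : Type*}

/-- Backlog of a codeword queue with `l` bits arriving in every slot and random service. -/
def constantInputBacklog (l : ℝ) (srv : ℕ → Ω → ℝ) (t : ℕ) (ω : Ω) : ℝ :=
  codewordBacklog (fun _ => l) (fun s => srv s ω) t

variable {l V : ℝ} {srv : ℕ → Ω → ℝ}

lemma constantInputBacklog_succ_sq_le (hl : 0 ≤ l) (hsrv : ∀ t ω, srv t ω ∈ Set.Icc 0 V) (t : ℕ)
    (ω : Ω) : constantInputBacklog l srv (t + 1) ω ^ 2 ≤
      constantInputBacklog l srv t ω ^ 2 + (V ^ 2 + l ^ 2) +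
        2 * (l * constantInputBacklog l srv t ω - constantInputBacklog l srv t ω * srv t ω) := by
  obtain ⟨hsrv0, hsrvV⟩ := hsrv t ω
  have hsq : srv t ω ^ 2 ≤ V ^ 2 := pow_le_pow_left₀ hsrv0 hsrvV 2
  set q := constantInputBacklog l srv t ω
  have hq0 : 0 ≤ q := codewordBacklog_nonneg (fun _ => hl) t
  have hstep : constantInputBacklog l srv (t + 1) ω = max (q - srv t ω) 0 + l := rfl
  rw [hstep]
  rcases le_total (q - srv t ω) 0 with hempty | hbusy
  · rw [max_eq_right hempty]
    nlinarith [sq_nonneg (q - srv t ω), mul_nonneg hl hq0]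
  · rw [max_eq_left hbusy]
    nlinarith [mul_nonneg hl hsrv0]

variable [MeasurableSpace Ω] {prob : Measure Ω} [IsProbabilityMeasure prob]

lemma memLp_constantInputBacklog (hl : 0 ≤ l) (hmeas : ∀ t, Measurable (srv t))
    (hsrv : ∀ t ω, 0 ≤ srv t ω) (t : ℕ) (p : ℝ≥0∞) :
    MemLp (constantInputBacklog l srv t) p prob := by
  have hmeasQ : Measurable (constantInputBacklog l srv t) :=
    measurable_codewordBacklog t (fun _ _ => measurable_const) fun s _ => hmeas s
  refine MemLp.of_bound hmeasQ.aestronglyMeasurable (t * l) (ae_of_all _ fun ω => ?_)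
  rw [constantInputBacklog, Real.norm_of_nonneg (codewordBacklog_nonneg (fun _ => hl) t)]
  simpa using codewordBacklog_le_sum (arr := fun _ => l) (fun _ => hl) (fun s => hsrv s ω) t

variable {c : ℝ} (hl : 0 ≤ l) (hmeas : ∀ t, Measurable (srv t))
  (hsrv : ∀ t ω, srv t ω ∈ Set.Icc 0 V) (hmean : ∀ t, ∫ ω, srv t ω ∂prob = c)
  (hindep : ∀ t, ProbabilityTheory.IndepFun (constantInputBacklog l srv t) (srv t) prob)

include hl hmeas hsrv hmean hindep

lemma integral_constantInputBacklog_succ_sq_le (t : ℕ) :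
    ∫ ω, constantInputBacklog l srv (t + 1) ω ^ 2 ∂prob ≤
      ∫ ω, constantInputBacklog l srv t ω ^ 2 ∂prob + (V ^ 2 + l ^ 2) -
        2 * (c - l) * ∫ ω, constantInputBacklog l srv t ω ∂prob := by
  have hLp := memLp_constantInputBacklog (prob := prob) hl hmeas fun t ω => (hsrv t ω).1
  have hint := (hLp t 1).integrable le_rfl
  have hsrv_int : Integrable (srv t) prob :=
    Integrable.of_mem_Icc 0 V (hmeas t).aemeasurable (ae_of_all _ (hsrv t))
  have hprod := (hindep t).integrable_mul hint hsrv_int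
  have hlyapunov := (hLp t 2).integrable_sq.add (integrable_const (V ^ 2 + l ^ 2))
  have hdrift := ((hint.const_mul l).sub hprod).const_mul 2
  refine (integral_mono (hLp (t + 1) 2).integrable_sq (hlyapunov.add hdrift)
    (constantInputBacklog_succ_sq_le hl hsrv t)).trans_eq ?_
  have hmul := (hindep t).integral_mul_eq_mul_integral hint.aestronglyMeasurable
    hsrv_int.aestronglyMeasurable
  rw [integral_add' hlyapunov hdrift, integral_add' (hLp t 2).integrable_sq (integrable_const _),
    integral_const_mul, integral_sub' (hint.const_mul l) hprod, hmul, integral_const_mul, hmean]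
  simp only [integral_const, probReal_univ, smul_eq_mul]
  ring

theorem sum_integral_constantInputBacklog_le (hlc : l < c) (T : ℕ) :
    ∑ t ∈ Finset.range T, ∫ ω, constantInputBacklog l srv t ω ∂prob ≤
      T * ((V ^ 2 + l ^ 2) / (2 * (c - l))) := by
  have htelescope : ∫ ω, constantInputBacklog l srv T ω ^ 2 ∂prob +
      2 * (c - l) * ∑ t ∈ Finset.range T, ∫ ω, constantInputBacklog l srv t ω ∂prob ≤
        T * (V ^ 2 + l ^ 2) := by
    induction T with
    | zero => simp [constantInputBacklog, codewordBacklog]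
    | succ T ih =>
      rw [Finset.sum_range_succ]
      push_cast
      linarith [integral_constantInputBacklog_succ_sq_le hl hmeas hsrv hmean hindep T]
  have hsq : 0 ≤ ∫ ω, constantInputBacklog l srv T ω ^ 2 ∂prob :=
    integral_nonneg fun ω => sq_nonneg _
  rw [← mul_div_assoc, le_div_iff₀ (by linarith)]
  linarith

end ConstantInput

/-! ### Integer sequences with a prescribed rate -/

/-- Increments of `⌊c t⌋`: integers with averages tending to `c`. -/
def floorIncrement (c : ℝ) (t : ℕ) : ℕ :=
  ⌊c * (t + 1 : ℕ)⌋₊ - ⌊c * t⌋₊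

section FloorIncrement

variable {c : ℝ} (hc : 0 ≤ c)

include hc

lemma sum_floorIncrement (t : ℕ) : ∑ s ∈ Finset.range t, floorIncrement c s = ⌊c * t⌋₊ := by
  have hmono : Monotone fun t : ℕ => ⌊c * t⌋₊ := fun s t hst =>
    Nat.floor_mono (mul_le_mul_of_nonneg_left (Nat.cast_le.2 hst) hc)
  simpa [floorIncrement] using Finset.sum_range_tsub hmono t

lemma floorIncrement_le {m : ℕ} (hm : c ≤ m) (t : ℕ) : floorIncrement c t ≤ m := by
  rw [floorIncrement, Nat.sub_le_iff_le_add, add_comm m, ← Nat.floor_add_natCast (by positivity)]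
  refine Nat.floor_mono ?_
  push_cast
  linarith

end FloorIncrement

lemma exists_le_sum_eq {ι : Type*} [Fintype ι] {u : ι → ℕ} {n : ℕ} (hn : n ≤ ∑ i, u i) :
    ∃ x ≤ u, ∑ i, x i = n := by
  classical
  induction n with
  | zero => exact ⟨0, fun _ => Nat.zero_le _, by simp⟩
  | succ n ih =>
    obtain ⟨x, hx, hsum⟩ := ih (by lia)
    obtain ⟨i, -, hi⟩ := Finset.exists_lt_of_sum_lt (s := Finset.univ) (f := x) (g := u) (by lia)
    refine ⟨x + Pi.single i 1, fun j => ?_, by simp [Finset.sum_add_distrib, hsum]⟩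
    rcases eq_or_ne j i with rfl | hji
    · simpa using hi
    · simpa [hji] using hx j

lemma tendsto_ennreal_div {D : ℕ → ℕ} {r : ℝ≥0}
    (h : Tendsto (fun t : ℕ => (D t : ℝ) / t) atTop (𝓝 r)) :
    Tendsto (fun t : ℕ => (D t : ℝ≥0∞) / (t : ℝ≥0∞)) atTop (𝓝 r) := by
  have hofReal := ENNReal.tendsto_ofReal h
  rw [ENNReal.ofReal_coe_nnreal] at hofReal
  refine hofReal.congr' ?_
  filter_upwards [eventually_gt_atTop 0] with t ht
  rw [ENNReal.ofReal_div_of_pos (Nat.cast_pos.2 ht), ENNReal.ofReal_natCast,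
    ENNReal.ofReal_natCast]

/-! ### The i.i.d. channel -/

namespace CachingSystem

variable {K : ℕ} (sys : CachingSystem K)

/-- The law of the channel state in a slot. -/
def channelLaw : Measure (Fin sys.numStates) :=
  ∑ s, ENNReal.ofReal (sys.φ s) • Measure.dirac s

lemma channelLaw_singleton (s : Fin sys.numStates) :
    sys.channelLaw {s} = ENNReal.ofReal (sys.φ s) := by
  simp [channelLaw, Set.indicator_apply]

instance : IsProbabilityMeasure sys.channelLaw where
  measure_univ := by
    simp only [channelLaw, Measure.coe_finsetSum, Finset.sum_apply, Measure.smul_apply,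
      measure_univ, smul_eq_mul, mul_one]
    rw [← ENNReal.ofReal_sum_of_nonneg fun s _ => sys.φ_nonneg s, sys.φ_sum, ENNReal.ofReal_one]

/-- The law of the sequence of channel states. -/
def pathLaw : Measure (ℕ → Fin sys.numStates) :=
  Measure.infinitePi fun _ => sys.channelLaw

instance : IsProbabilityMeasure sys.pathLaw :=
  inferInstanceAs (IsProbabilityMeasure (Measure.infinitePi fun _ => sys.channelLaw))

lemma map_eval_pathLaw (t : ℕ) : sys.pathLaw.map (fun ω => ω t) = sys.channelLaw :=
  Measure.infinitePi_map_eval (fun _ => sys.channelLaw) t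

lemma pathLaw_preimage_singleton (t : ℕ) (s : Fin sys.numStates) :
    sys.pathLaw ((fun ω => ω t) ⁻¹' {s}) = ENNReal.ofReal (sys.φ s) := by
  rw [← sys.channelLaw_singleton, ← sys.map_eval_pathLaw t,
    Measure.map_apply (measurable_pi_apply t) (measurableSet_singleton s)]

lemma iIndepFun_pathLaw :
    ProbabilityTheory.iIndepFun (fun (t : ℕ) (ω : ℕ → Fin sys.numStates) => ω t) sys.pathLaw :=
  ProbabilityTheory.iIndepFun_infinitePi (P := fun _ : ℕ => sys.channelLaw)
    (X := fun _ => id) fun _ => measurable_id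

lemma indep_piLE_pathLaw (t : ℕ) : ProbabilityTheory.Indep
    (Filtration.piLE (X := fun _ : ℕ => Fin sys.numStates) t)
    (MeasurableSpace.comap (fun ω : ℕ → Fin sys.numStates => ω (t + 1)) ⊤) sys.pathLaw := by
  have hblocks := sys.iIndepFun_pathLaw.indepFun_finset (Finset.Iic t) {t + 1} (by simp)
    fun i => measurable_pi_apply i
  rw [Filtration.piLE_eq_comap_frestrictLe]
  exact hblocks.comp measurable_id
    (measurable_pi_apply (⟨t + 1, by simp⟩ : ({t + 1} : Finset ℕ)))

lemma integral_pathLaw (g : Fin sys.numStates → ℝ) (t : ℕ) :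
    ∫ ω, g (ω t) ∂sys.pathLaw = ∑ s, sys.φ s * g s := by
  rw [← integral_map (f := g) (φ := fun ω : ℕ → Fin sys.numStates => ω t)
    (measurable_pi_apply t).aemeasurable measurable_from_top.aestronglyMeasurable,
    map_eval_pathLaw, integral_fintype Integrable.of_finite]
  refine Finset.sum_congr rfl fun s _ => ?_
  rw [Measure.real, channelLaw_singleton, ENNReal.toReal_ofReal (sys.φ_nonneg s), smul_eq_mul]

lemma integrable_pathLaw (g : Fin sys.numStates → ℝ) (t : ℕ) :
    Integrable (fun ω => g (ω t)) sys.pathLaw := by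
  have hint : Integrable g (sys.pathLaw.map fun ω => ω t) := by
    rw [map_eval_pathLaw]
    exact Integrable.of_finite
  exact hint.comp_measurable (measurable_pi_apply t)

theorem ae_tendsto_average (g : Fin sys.numStates → ℝ) :
    ∀ᵐ ω ∂sys.pathLaw, Tendsto (fun t : ℕ => (∑ s ∈ Finset.range t, g (ω s)) / t) atTop
      (𝓝 (∑ s, sys.φ s * g s)) := by
  have hg : Measurable g := measurable_from_top
  have hident : ∀ t, ProbabilityTheory.IdentDistrib (fun ω : ℕ → Fin sys.numStates => g (ω t))
      (fun ω => g (ω 0)) sys.pathLaw sys.pathLaw := fun t =>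
    ProbabilityTheory.IdentDistrib.comp (u := g) ⟨(measurable_pi_apply t).aemeasurable,
      (measurable_pi_apply 0).aemeasurable, by rw [map_eval_pathLaw, map_eval_pathLaw]⟩ hg
  simpa only [integral_pathLaw] using ProbabilityTheory.strong_law_ae_real
    (fun t (ω : ℕ → Fin sys.numStates) => g (ω t)) (sys.integrable_pathLaw g 0)
    (fun i j hij => (sys.iIndepFun_pathLaw.indepFun hij).comp hg hg) hident

end CachingSystem

/-! ### Delivery rates of schemes with sublinear backlogs -/

namespace CachingSystem.Scheme

variable {K : ℕ} {sys : CachingSystem K} (π : Scheme sys) (k : Fin K) (I : UserGroup K) (t : ℕ)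
  (ω : π.Ω)

lemma sum_x_add_S : ∑ s ∈ Finset.range t, ∑ J, π.x s ω k J + π.S k t ω =
    ∑ s ∈ Finset.range t, π.a s ω k := by
  rw [S, Finset.sum_congr rfl fun s _ => π.x_sum s ω k, sum_min_add_userBacklog]

lemma carriedThrough_le_delivered : π.carriedThrough k t ω ≤ π.delivered k t ω := by
  refine Finset.sum_le_sum fun s _ => Finset.sum_le_sum fun J _ => ?_
  split_ifs with hall hmine
  · exact le_rfl
  · exact absurd (fun I _ => hall I) hmine
  · exact Nat.zero_le _
  · exact le_rfl

lemma delivered_le_sum_a : π.delivered k t ω ≤ ∑ s ∈ Finset.range t, π.a s ω k := by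
  rw [← sum_x_add_S]
  refine le_add_right (Finset.sum_le_sum fun s _ => Finset.sum_le_sum fun J _ => ?_)
  split_ifs
  exacts [le_rfl, Nat.zero_le _]

open Classical in
/-- Number of slots before `t` whose codewords for `I` have not all been multicast before `t`. -/
def untransmitted : ℕ :=
  (Finset.range t |>.filter fun s => ¬ π.Transmitted I s t ω).card

lemma sum_x_le_carriedThrough_add : ∑ s ∈ Finset.range t, ∑ J, π.x s ω k J ≤
    π.carriedThrough k t ω +
      Fintype.card (UserGroup K) * sys.σmax * ∑ I, π.untransmitted I t ω := by
  classical
  have hterm : ∀ s J, π.x s ω k J ≤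
      (if ∀ I : UserGroup K, I.1 ⊆ J.1 → π.Transmitted I s t ω then π.x s ω k J else 0) +
        sys.σmax * ∑ I : UserGroup K, if ¬ π.Transmitted I s t ω then 1 else 0 := by
    intro s J
    split_ifs with h
    · exact Nat.le_add_right _ _
    · push Not at h
      obtain ⟨I, -, hI⟩ := h
      have hone : 1 ≤ ∑ I : UserGroup K, if ¬ π.Transmitted I s t ω then 1 else 0 :=
        (if_pos hI).symm.le.trans (Finset.single_le_sum
          (f := fun I => if ¬ π.Transmitted I s t ω then 1 else 0)
          (fun _ _ => Nat.zero_le _) (Finset.mem_univ I))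
      rw [zero_add]
      exact (π.x_le_σmax s ω k J).trans (Nat.le_mul_of_pos_right _ hone)
  refine (Finset.sum_le_sum fun s _ => Finset.sum_le_sum fun J _ => hterm s J).trans_eq ?_
  simp only [Finset.sum_add_distrib]
  congr 1
  simp only [Finset.sum_const, Finset.card_univ, smul_eq_mul, ← Finset.mul_sum, mul_assoc,
    untransmitted, Finset.card_filter]
  rw [Finset.sum_comm]

variable {k I ω} {l B : ℝ} (hle : ∀ t : ℕ, π.created I t ω ≤ l * t)
  (hge : ∀ t : ℕ, l * t - B ≤ π.created I t ω)

include hle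

lemma untransmitted_eq_zero (hl : l ≤ 0) : π.untransmitted I t ω = 0 := by
  classical
  refine Finset.card_eq_zero.2 (Finset.filter_false_of_mem fun s _ => not_not.2 ?_)
  exact (hle (s + 1)).trans ((mul_nonpos_of_nonpos_of_nonneg hl (Nat.cast_nonneg _)).trans
    (π.sent_nonneg I t ω))

include hge

-- What is still queued at time `t` arrived during roughly the last `Q / l` slots.
lemma untransmitted_le (hl : 0 < l) : (π.untransmitted I t ω : ℝ) ≤ (B + π.Q I t ω) / l + 1 := by
  classical
  have hB : 0 ≤ B := by simpa [created] using hge 0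
  set y := (B + π.Q I t ω) / l
  have hy : 0 ≤ y := div_nonneg (add_nonneg hB (π.Q_nonneg I t ω)) hl.le
  have hrecent : {s ∈ Finset.range t | ¬ π.Transmitted I s t ω} ⊆ Finset.Ico (t - ⌈y⌉₊) t := by
    intro s hs
    obtain ⟨hst, hs⟩ := Finset.mem_filter.1 hs
    have hqueued : π.created I t ω - π.Q I t ω < π.created I (s + 1) ω := not_le.1 hs
    have hlate : (t - (s + 1 : ℕ) : ℝ) < y := by
      rw [lt_div_iff₀ hl]
      linarith [hle (s + 1), hge t]
    have hts : (t : ℝ) < (s + 1 + ⌈y⌉₊ : ℕ) := by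
      push_cast at hlate ⊢
      linarith [Nat.le_ceil y]
    have hts' := Nat.cast_lt.1 hts
    exact Finset.mem_Ico.2 ⟨by lia, Finset.mem_range.1 hst⟩
  have hcard : π.untransmitted I t ω ≤ ⌈y⌉₊ :=
    (Finset.card_le_card hrecent).trans (by rw [Nat.card_Ico]; lia)
  exact (Nat.cast_le.2 hcard).trans (Nat.ceil_lt_add_one hy).le

theorem tendsto_untransmitted_div
    (hQ : Tendsto (fun t : ℕ => π.Q I t ω / t) atTop (𝓝 0)) :
    Tendsto (fun t : ℕ => (π.untransmitted I t ω : ℝ) / t) atTop (𝓝 0) := by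
  rcases le_or_gt l 0 with hl | hl
  · simp [π.untransmitted_eq_zero _ hle hl]
  · have hlim : Tendsto (fun t : ℕ => (B / l + 1) / t + π.Q I t ω / t / l) atTop (𝓝 0) := by
      simpa using (tendsto_const_div_atTop_nhds_zero_nat (B / l + 1)).add (hQ.div_const l)
    refine squeeze_zero (fun t => by positivity) (fun t => ?_) hlim
    refine (div_le_div_of_nonneg_right (π.untransmitted_le t hle hge hl)
      (Nat.cast_nonneg t)).trans_eq ?_
    ring

omit hle hge

variable {r : ℝ} (ha : Tendsto (fun t : ℕ => (∑ s ∈ Finset.range t, π.a s ω k : ℝ) / t) atTop (𝓝 r))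

include ha

theorem tendsto_carriedThrough_div
    (hS : Tendsto (fun t : ℕ => (π.S k t ω : ℝ) / t) atTop (𝓝 0))
    (hU : ∀ I, Tendsto (fun t : ℕ => (π.untransmitted I t ω : ℝ) / t) atTop (𝓝 0)) :
    Tendsto (fun t : ℕ => (π.carriedThrough k t ω : ℝ) / t) atTop (𝓝 r) := by
  set C : ℝ := Fintype.card (UserGroup K) * sys.σmax with hC
  have hlower := (ha.sub hS).sub
    ((tendsto_finsetSum Finset.univ fun I _ => hU I).const_mul C)
  simp only [Finset.sum_const_zero, mul_zero, sub_zero] at hlower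
  refine tendsto_of_tendsto_of_tendsto_of_le_of_le hlower ha (fun t => ?_) fun t => ?_
  · have hadm : (∑ s ∈ Finset.range t, π.a s ω k : ℝ) ≤
        π.carriedThrough k t ω + C * ∑ I, (π.untransmitted I t ω : ℝ) + π.S k t ω := by
      rw [hC]
      exact_mod_cast (π.sum_x_add_S k t ω).symm.trans_le
        (Nat.add_le_add_right (π.sum_x_le_carriedThrough_add k t ω) _)
    beta_reduce
    rw [← Finset.sum_div, ← mul_div_assoc, ← sub_div, ← sub_div]
    exact div_le_div_of_nonneg_right (by linarith) (Nat.cast_nonneg t)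
  · refine div_le_div_of_nonneg_right ?_ (Nat.cast_nonneg t)
    rw [← Nat.cast_sum, Nat.cast_le]
    exact (π.carriedThrough_le_delivered k t ω).trans (π.delivered_le_sum_a k t ω)

theorem tendsto_delivered_div
    (hcarried : Tendsto (fun t : ℕ => (π.carriedThrough k t ω : ℝ) / t) atTop (𝓝 r)) :
    Tendsto (fun t : ℕ => (π.delivered k t ω : ℝ) / t) atTop (𝓝 r) := by
  refine tendsto_of_tendsto_of_tendsto_of_le_of_le hcarried ha (fun t => ?_) fun t => ?_
  · exact div_le_div_of_nonneg_right (Nat.cast_le.2 (π.carriedThrough_le_delivered k t ω))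
      (Nat.cast_nonneg t)
  · refine div_le_div_of_nonneg_right ?_ (Nat.cast_nonneg t)
    rw [← Nat.cast_sum, Nat.cast_le]
    exact π.delivered_le_sum_a k t ω

end CachingSystem.Scheme

/-! ### A scheme for the rates in the interior of `Γcc` -/

section FloorRates

variable {ι : Type*} {L : (ι → ℝ) →ₗ[ℝ] ℝ} (hL : Monotone L) {f : ι → ℝ}

include hL

lemma map_floor_mul_le (hf : ∀ i, 0 ≤ f i) (t : ℕ) :
    L (fun i => (⌊f i * t⌋₊ : ℝ)) ≤ L f * t := by
  rw [mul_comm, ← smul_eq_mul, ← map_smul]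
  exact hL fun i => (Nat.floor_le (mul_nonneg (hf i) t.cast_nonneg)).trans_eq (mul_comm _ _)

lemma sub_le_map_floor_mul (f : ι → ℝ) (t : ℕ) :
    L f * t - L 1 ≤ L fun i => (⌊f i * t⌋₊ : ℝ) := by
  rw [mul_comm, ← smul_eq_mul, ← map_smul, ← map_sub]
  refine hL fun i => ?_
  simp only [Pi.sub_apply, Pi.smul_apply, Pi.one_apply, smul_eq_mul, mul_comm (t : ℝ)]
  exact sub_le_iff_le_add.2 (Nat.lt_floor_add_one _).le

end FloorRates

lemma limsup_average_lt_top {g : ℕ → ℝ≥0∞} {C : ℝ≥0∞} (hC : C < ⊤)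
    (h : ∀ T : ℕ, ∑ t ∈ Finset.range T, g t ≤ C * T) :
    limsup (fun T : ℕ => (∑ t ∈ Finset.range T, g t) / (T : ℝ≥0∞)) atTop < ⊤ :=
  (limsup_le_of_le (h := .of_forall fun T => ENNReal.div_le_of_le_mul (h T))).trans_lt hC

lemma tendsto_floor_mul_div (r : ℝ≥0) :
    Tendsto (fun t : ℕ => (⌊(r : ℝ) * t⌋₊ : ℝ) / t) atTop (𝓝 r) :=
  (tendsto_nat_floor_mul_div_atTop r.2).comp tendsto_natCast_atTop_atTop

namespace CachingSystem

variable {K : ℕ} (sys : CachingSystem K)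

/-- Long-term rates that certify membership in `Γcc` with slack in all codeword queues: files of
user `k` are admitted at rate `r k`, combinations for `J` are made at rate `f J`, and the
transmission rates are `ν s` whenever the channel is in the state `s`. Codeword queues without
any input need no slack. -/
structure RatePlan where
  r : Fin K → ℝ≥0
  f : UserGroup K → ℝ
  f_nonneg : ∀ J, 0 ≤ f J
  f_le : ∀ J, f J ≤ sys.σmax
  ν : Fin sys.numStates → UserGroup K → ℝ
  ν_mem : ∀ s, ν s ∈ capacityRegion sys.P (sys.gain s)
  r_le : ∀ k, (r k : ℝ) ≤ userTotal k f
  load_slack : ∀ I, sys.load I f = 0 ∨ sys.load I f < sys.Tslot * (∑ s, sys.φ s • ν s) I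

namespace RatePlan

variable {sys} (p : RatePlan sys)

lemma exists_assignment (t : ℕ) (k : Fin K) : ∃ x : UserGroup K → ℕ,
    (∀ J, x J ≤ if k ∈ J.1 then floorIncrement (p.f J) t else 0) ∧
      ∑ J, x J = min (userBacklog (floorIncrement (p.r k))
          (fun s => ∑ J : UserGroup K with k ∈ J.1, floorIncrement (p.f J) s) t)
        (∑ J : UserGroup K with k ∈ J.1, floorIncrement (p.f J) t) :=
  exists_le_sum_eq ((min_le_right _ _).trans_eq (Finset.sum_filter _ _))

lemma measurable_eval_piLE {X : Type*} [MeasurableSpace X] (g : Fin sys.numStates → X) (t : ℕ) :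
    Measurable[Filtration.piLE (X := fun _ : ℕ => Fin sys.numStates) t]
      fun ω : ℕ → Fin sys.numStates => g (ω t) := by
  have hlast : Measurable fun y : Set.Iic t → Fin sys.numStates => g (y ⟨t, Set.self_mem_Iic⟩) :=
    (measurable_from_top (f := g)).comp (measurable_pi_apply _)
  exact hlast.comp (comap_measurable (Preorder.restrictLe (π := fun _ : ℕ => Fin sys.numStates) t))

/-- The scheme that carries out the plan. Admissions and combinations are deterministic, with
`⌊r k * t⌋` and `⌊f J * t⌋` of them before slot `t`; only the rates follow the channel. -/
def scheme : Scheme sys where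
  Ω := ℕ → Fin sys.numStates
  prob := sys.pathLaw
  ℱ := Filtration.piLE
  h t ω := ω t
  h_adapted t := measurable_eval_piLE id t
  h_law := sys.pathLaw_preimage_singleton
  h_indep := sys.indep_piLE_pathLaw
  a t _ k := floorIncrement (p.r k) t
  a_adapted _ := measurable_const
  σ t _ J := floorIncrement (p.f J) t
  σ_adapted _ := measurable_const
  σ_le t _ J := floorIncrement_le (p.f_nonneg J) (p.f_le J) t
  μ t ω := p.ν (ω t)
  μ_adapted t := measurable_eval_piLE p.ν t
  μ_mem t ω := p.ν_mem (ω t)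
  x t _ k := (p.exists_assignment t k).choose
  x_adapted _ := measurable_const
  x_le t _ k := (p.exists_assignment t k).choose_spec.1
  x_sum t _ k := (p.exists_assignment t k).choose_spec.2

lemma sum_a_scheme (k : Fin K) (t : ℕ) (ω : p.scheme.Ω) :
    ∑ s ∈ Finset.range t, p.scheme.a s ω k = ⌊(p.r k : ℝ) * t⌋₊ :=
  sum_floorIncrement (p.r k).coe_nonneg t

lemma combinations_scheme (t : ℕ) (ω : p.scheme.Ω) :
    p.scheme.combinations t ω = fun J => (⌊p.f J * t⌋₊ : ℝ) := by
  ext J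
  rw [Scheme.combinations, Finset.sum_apply, ← sum_floorIncrement (p.f_nonneg J), Nat.cast_sum]
  rfl

lemma tendsto_sum_a_div (k : Fin K) (ω : p.scheme.Ω) :
    Tendsto (fun t : ℕ => (∑ s ∈ Finset.range t, p.scheme.a s ω k : ℝ) / t) atTop
      (𝓝 (p.r k)) := by
  simp only [← Nat.cast_sum, sum_a_scheme]
  exact tendsto_floor_mul_div (p.r k)

theorem hasAdmissionRate : p.scheme.HasAdmissionRate p.r := fun k => by
  refine (tendsto_ennreal_div (tendsto_floor_mul_div (p.r k))).congr fun T => ?_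
  have hconst : ∀ t, ∫⁻ ω, (p.scheme.a t ω k : ℝ≥0∞) ∂p.scheme.prob =
      floorIncrement (p.r k) t := fun t =>
    (lintegral_const (μ := p.scheme.prob) (floorIncrement (p.r k) t : ℝ≥0∞)).trans
      (by rw [measure_univ, mul_one])
  simp only [hconst, ← Nat.cast_sum, sum_floorIncrement (p.r k).coe_nonneg]

section UserQueue

lemma S_scheme_le (k : Fin K) (t : ℕ) (ω : p.scheme.Ω) :
    (p.scheme.S k t ω : ℝ) ≤ userTotal k 1 + 1 + ⌈(p.r k : ℝ)⌉₊ := by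
  have hmono : Monotone (userTotal k) := fun _ _ h => userTotal_le_userTotal k h
  let requests : ℕ → ℕ := fun s => ∑ J : UserGroup K with k ∈ J.1, p.scheme.σ s ω J
  obtain ⟨s, hst, hbacklog⟩ := exists_codewordBacklog_le_net_input
    (arr := fun s => (p.scheme.a s ω k : ℝ)) (srv := fun s => (requests s : ℝ))
    (Nat.cast_nonneg ⌈(p.r k : ℝ)⌉₊)
    (fun t => Nat.cast_le.2 (floorIncrement_le (p.r k).coe_nonneg (Nat.le_ceil _) t)) t
  have hrequests : ∀ t, ∑ s ∈ Finset.range t, (requests s : ℝ) =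
      userTotal k fun J => (⌊p.f J * t⌋₊ : ℝ) := fun t => by
    rw [← p.combinations_scheme t ω, Scheme.combinations, map_sum]
    exact Finset.sum_congr rfl fun s _ => (userTotal_natCast k _).symm
  rw [← cast_userBacklog, hrequests, hrequests, ← Nat.cast_sum, ← Nat.cast_sum, sum_a_scheme,
    sum_a_scheme] at hbacklog
  have hadmitted : (⌊(p.r k : ℝ) * t⌋₊ : ℝ) ≤ p.r k * t := Nat.floor_le (by positivity)
  have hadmitted' := Nat.lt_floor_add_one ((p.r k : ℝ) * s)
  have hslack : (p.r k - userTotal k p.f) * t ≤ (p.r k - userTotal k p.f) * (s : ℝ) :=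
    mul_le_mul_of_nonpos_left (Nat.cast_le.2 hst) (sub_nonpos.2 (p.r_le k))
  rw [Scheme.S]
  linarith [sub_le_map_floor_mul hmono p.f t, map_floor_mul_le hmono p.f_nonneg s]

lemma tendsto_S_div (k : Fin K) (ω : p.scheme.Ω) :
    Tendsto (fun t : ℕ => (p.scheme.S k t ω : ℝ) / t) atTop (𝓝 0) :=
  squeeze_zero (fun t => by positivity)
    (fun t => div_le_div_of_nonneg_right (p.S_scheme_le k t ω) t.cast_nonneg)
    (tendsto_const_div_atTop_nhds_zero_nat _)

lemma limsup_average_S_lt_top (k : Fin K) : limsup (fun T : ℕ =>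
    (∑ t ∈ Finset.range T, ∫⁻ ω, (p.scheme.S k t ω : ℝ≥0∞) ∂p.scheme.prob) / (T : ℝ≥0∞))
      atTop < ⊤ := by
  set B : ℝ := userTotal k 1 + 1 + ⌈(p.r k : ℝ)⌉₊
  refine limsup_average_lt_top (ENNReal.ofReal_lt_top (r := B)) fun T => ?_
  calc _ ≤ ∑ _t ∈ Finset.range T, ∫⁻ _, ENNReal.ofReal B ∂p.scheme.prob :=
        Finset.sum_le_sum fun t _ => lintegral_mono fun ω => by
          rw [← ENNReal.ofReal_natCast]
          exact ENNReal.ofReal_le_ofReal (p.S_scheme_le k t ω)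
    _ = ENNReal.ofReal B * T := by simp [mul_comm]

end UserQueue

section CodewordQueue

variable (I : UserGroup K)

lemma created_scheme_le (t : ℕ) (ω : p.scheme.Ω) :
    p.scheme.created I t ω ≤ sys.load I p.f * t := by
  rw [Scheme.created_eq_load, combinations_scheme]
  exact map_floor_mul_le (fun _ _ h => sys.load_mono I h) p.f_nonneg t

lemma sub_le_created_scheme (t : ℕ) (ω : p.scheme.Ω) :
    sys.load I p.f * t - sys.load I 1 ≤ p.scheme.created I t ω := by
  rw [Scheme.created_eq_load, combinations_scheme]
  exact sub_le_map_floor_mul (fun _ _ h => sys.load_mono I h) p.f t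

lemma arrivals_scheme_le (t : ℕ) (ω : p.scheme.Ω) :
    p.scheme.arrivals I t ω ≤ sys.load I fun _ => sys.σmax := by
  rw [Scheme.arrivals_eq_load]
  exact sys.load_mono I fun J => Nat.cast_le.2 (p.scheme.σ_le t ω J)

lemma tendsto_created_div (ω : p.scheme.Ω) :
    Tendsto (fun t : ℕ => p.scheme.created I t ω / t) atTop (𝓝 (sys.load I p.f)) := by
  have hlower := (tendsto_const_div_atTop_nhds_zero_nat (sys.load I 1)).const_sub (sys.load I p.f)
  rw [sub_zero] at hlower
  refine tendsto_of_tendsto_of_tendsto_of_le_of_le' hlower tendsto_const_nhds ?_ ?_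
  all_goals
    filter_upwards [eventually_gt_atTop 0] with t ht
    have htpos : (0 : ℝ) < t := Nat.cast_pos.2 ht
  · rw [le_div_iff₀ htpos, sub_mul, div_mul_cancel₀ _ htpos.ne']
    exact p.sub_le_created_scheme I t ω
  · rw [div_le_iff₀ htpos]
    exact p.created_scheme_le I t ω

variable {I}

lemma Q_scheme_eq_zero (h : sys.load I p.f = 0) (t : ℕ) (ω : p.scheme.Ω) :
    p.scheme.Q I t ω = 0 := by
  have hcreated := p.created_scheme_le I t ω
  rw [h, zero_mul] at hcreated
  exact ((sub_nonneg.1 (p.scheme.sent_nonneg I t ω)).trans hcreated).antisymm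
    (p.scheme.Q_nonneg I t ω)

variable (I)

lemma sum_φ_mul_service : ∑ s, sys.φ s * (sys.Tslot * p.ν s I) =
    sys.Tslot * (∑ s, sys.φ s • p.ν s) I := by
  simp only [Finset.sum_apply, Pi.smul_apply, smul_eq_mul, Finset.mul_sum]
  exact Finset.sum_congr rfl fun s _ => mul_left_comm _ _ _

lemma ae_tendsto_Q_div :
    ∀ᵐ ω ∂p.scheme.prob, Tendsto (fun t : ℕ => p.scheme.Q I t ω / t) atTop (𝓝 0) := by
  rcases p.load_slack I with hidle | hslack
  · exact ae_of_all _ fun ω => by simp [p.Q_scheme_eq_zero hidle]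
  · filter_upwards [sys.ae_tendsto_average fun s => sys.Tslot * p.ν s I] with ω hω
    rw [sum_φ_mul_service] at hω
    exact tendsto_codewordBacklog_div (fun s => p.scheme.arrivals_nonneg I s ω)
      (fun s => p.arrivals_scheme_le I s ω) hslack.le (p.tendsto_created_div I ω) hω

end CodewordQueue

section Delivery

lemma ae_tendsto_carriedThrough_div : ∀ᵐ ω ∂p.scheme.prob, ∀ k,
    Tendsto (fun t : ℕ => (p.scheme.carriedThrough k t ω : ℝ) / t) atTop (𝓝 (p.r k)) := by
  filter_upwards [ae_all_iff.2 p.ae_tendsto_Q_div] with ω hω k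
  exact p.scheme.tendsto_carriedThrough_div (p.tendsto_sum_a_div k ω) (p.tendsto_S_div k ω)
    fun I => p.scheme.tendsto_untransmitted_div (fun t => p.created_scheme_le I t ω)
      (fun t => p.sub_le_created_scheme I t ω) (hω I)

lemma ae_tendsto_delivered_div : ∀ᵐ ω ∂p.scheme.prob, ∀ k,
    Tendsto (fun t : ℕ => (p.scheme.delivered k t ω : ℝ) / t) atTop (𝓝 (p.r k)) := by
  filter_upwards [p.ae_tendsto_carriedThrough_div] with ω hω k
  exact p.scheme.tendsto_delivered_div (p.tendsto_sum_a_div k ω) (hω k)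

theorem hasDeliveryRate : p.scheme.HasDeliveryRate p.r := by
  filter_upwards [p.ae_tendsto_delivered_div] with ω hω k
  exact (tendsto_ennreal_div (hω k)).liminf_eq

theorem irrevocable : p.scheme.Irrevocable := by
  filter_upwards [p.ae_tendsto_delivered_div, p.ae_tendsto_carriedThrough_div]
    with ω hdelivered hcarried k
  simpa only [sub_div, sub_self] using (hdelivered k).sub (hcarried k)

end Delivery

section Stability

variable (I : UserGroup K)

/-- The backlog of `I` if bits arrived at the constant rate `load I f`, without rounding. -/
def smoothedQ : ℕ → p.scheme.Ω → ℝ :=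
  constantInputBacklog (sys.load I p.f) fun t ω => sys.Tslot * p.scheme.μ t ω I

lemma Q_scheme_le_smoothedQ_add (t : ℕ) (ω : p.scheme.Ω) :
    p.scheme.Q I t ω ≤ p.smoothedQ I t ω + sys.load I 1 := by
  have hexcess : p.scheme.Q I t ω ≤ p.smoothedQ I t ω +
      (p.scheme.created I t ω - sys.load I p.f * t + sys.load I 1) :=
    codewordBacklog_le_add_excess (fun t => p.sub_le_created_scheme I t ω) t
  linarith [p.created_scheme_le I t ω]

lemma measurable_service (t : ℕ) : Measurable fun ω => sys.Tslot * p.scheme.μ t ω I :=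
  measurable_const.mul (p.scheme.measurable_μ_apply t I)

lemma integral_service (t : ℕ) : ∫ ω, sys.Tslot * p.scheme.μ t ω I ∂p.scheme.prob =
    sys.Tslot * (∑ s, sys.φ s • p.ν s) I :=
  (sys.integral_pathLaw (fun s => sys.Tslot * p.ν s I) t).trans (p.sum_φ_mul_service I)

lemma indepFun_smoothedQ_service (t : ℕ) : ProbabilityTheory.IndepFun (p.smoothedQ I t)
    (fun ω => sys.Tslot * p.scheme.μ t ω I) p.scheme.prob := by
  rcases t with _ | t
  · exact ProbabilityTheory.indepFun_const_left 0 _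
  · have hrate : ∀ s < t + 1, Measurable[p.scheme.ℱ t]
        fun ω => sys.Tslot * p.scheme.μ s ω I := fun s hs => by
      have hμ := (p.scheme.μ_adapted s).mono (p.scheme.ℱ.mono (Nat.lt_succ_iff.1 hs)) le_rfl
      exact ((measurable_pi_apply I).const_mul sys.Tslot).comp hμ
    have hpast : Measurable[p.scheme.ℱ t] (p.smoothedQ I (t + 1)) :=
      @measurable_codewordBacklog _ (p.scheme.ℱ t) (t + 1) _ _
        (fun _ _ => @measurable_const _ _ _ (p.scheme.ℱ t) _) hrate
    have hstate : Measurable fun s : Fin sys.numStates => sys.Tslot * p.ν s I :=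
      measurable_from_top
    exact ProbabilityTheory.indep_of_indep_of_le_left
      (ProbabilityTheory.indep_of_indep_of_le_right (p.scheme.h_indep t)
        (hstate.comp (comap_measurable (p.scheme.h (t + 1)))).comap_le) hpast.comap_le

variable {I}

lemma exists_sum_integral_smoothedQ_le
    (h : sys.load I p.f < sys.Tslot * (∑ s, sys.φ s • p.ν s) I) :
    ∃ C : ℝ, ∀ T : ℕ, ∑ t ∈ Finset.range T, ∫ ω, p.smoothedQ I t ω ∂p.scheme.prob ≤ T * C := by
  obtain ⟨V, -, hV⟩ := sys.exists_rate_bound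
  exact ⟨_, sum_integral_constantInputBacklog_le (V := sys.Tslot * V)
    (sys.load_nonneg I p.f_nonneg) (p.measurable_service I)
    (fun t ω => ⟨p.scheme.service_nonneg I t ω,
      mul_le_mul_of_nonneg_left (hV _ _ (p.scheme.μ_mem t ω) I) sys.Tslot_pos.le⟩)
    (p.integral_service I) (p.indepFun_smoothedQ_service I) h⟩

lemma integral_Q_scheme_le (t : ℕ) : ∫ ω, p.scheme.Q I t ω ∂p.scheme.prob ≤
    ∫ ω, p.smoothedQ I t ω ∂p.scheme.prob + sys.load I 1 := by
  have hint : Integrable (p.smoothedQ I t) p.scheme.prob :=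
    (memLp_constantInputBacklog (sys.load_nonneg I p.f_nonneg) (p.measurable_service I)
      (p.scheme.service_nonneg I) t 1).integrable le_rfl
  refine (integral_mono (p.scheme.integrable_Q I t) (hint.add (integrable_const _))
    (p.Q_scheme_le_smoothedQ_add I t)).trans_eq ?_
  rw [integral_add' hint (integrable_const _)]
  simp

variable (I)

lemma exists_sum_integral_Q_le :
    ∃ C : ℝ, ∀ T : ℕ, ∑ t ∈ Finset.range T, ∫ ω, p.scheme.Q I t ω ∂p.scheme.prob ≤ T * C := by
  rcases p.load_slack I with hidle | hslack
  · exact ⟨0, fun T => by simp [p.Q_scheme_eq_zero hidle]⟩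
  · obtain ⟨C, hC⟩ := p.exists_sum_integral_smoothedQ_le hslack
    refine ⟨C + sys.load I 1, fun T => ?_⟩
    calc _ ≤ ∑ t ∈ Finset.range T, (∫ ω, p.smoothedQ I t ω ∂p.scheme.prob + sys.load I 1) :=
          Finset.sum_le_sum fun t _ => p.integral_Q_scheme_le t
      _ ≤ T * (C + sys.load I 1) := by
          rw [Finset.sum_add_distrib, mul_add, Finset.sum_const, Finset.card_range, nsmul_eq_mul]
          exact add_le_add_left (hC T) _

lemma limsup_average_Q_lt_top : limsup (fun T : ℕ =>
    (∑ t ∈ Finset.range T, ∫⁻ ω, ENNReal.ofReal (p.scheme.Q I t ω) ∂p.scheme.prob) /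
      (T : ℝ≥0∞)) atTop < ⊤ := by
  obtain ⟨C, hC⟩ := p.exists_sum_integral_Q_le I
  refine limsup_average_lt_top (ENNReal.ofReal_lt_top (r := C)) fun T => ?_
  have hQ := p.scheme.Q_nonneg I
  simp only [← ofReal_integral_eq_lintegral_ofReal (p.scheme.integrable_Q I _)
    (ae_of_all _ (hQ _))]
  rw [← ENNReal.ofReal_sum_of_nonneg fun t _ => integral_nonneg (hQ t), mul_comm,
    ← ENNReal.ofReal_natCast, ← ENNReal.ofReal_mul T.cast_nonneg]
  exact ENNReal.ofReal_le_ofReal (hC T)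

theorem stable : p.scheme.Stable :=
  ⟨p.limsup_average_S_lt_top, p.limsup_average_Q_lt_top⟩

end Stability

end RatePlan

theorem exists_ratePlan_of_mem_interior {r : Fin K → ℝ≥0} (hr : r ∈ interior sys.Γcc) :
    ∃ p : RatePlan sys, p.r = r := by
  obtain ⟨-, ⟨ν, hν, rfl⟩, f, hbox, huser, hslack⟩ := sys.exists_slack_of_mem_interior hr
  exact ⟨⟨r, f, fun J => (hbox J).1, fun J => (hbox J).2, ν, hν, huser, hslack⟩, rfl⟩

theorem interior_Γcc_subset_Λcc : interior sys.Γcc ⊆ sys.Λcc := fun r hr => by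
  obtain ⟨p, rfl⟩ := sys.exists_ratePlan_of_mem_interior hr
  exact ⟨p.scheme, p.irrevocable, p.hasDeliveryRate⟩

theorem interior_Γcc_subset_stabilityRegion : interior sys.Γcc ⊆ sys.stabilityRegion :=
  fun r hr => by
    obtain ⟨p, rfl⟩ := sys.exists_ratePlan_of_mem_interior hr
    exact ⟨p.scheme, p.hasAdmissionRate, p.stable⟩

theorem Λcc_subset_ΛccRevocable : sys.Λcc ⊆ sys.ΛccRevocable :=
  fun _ ⟨π, _, hπ⟩ => ⟨π, hπ⟩

end CachingSystem

theorem lemma1_general {K : ℕ} (sys : CachingSystem K) :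
    sys.Λcc \ frontier sys.Γcc = interior sys.Γcc ∧
    sys.stabilityRegion \ frontier sys.Γcc = interior sys.Γcc ∧
    ((∀ k, sys.Tslot * ∑ s, sys.φ s * Real.logb 2 (1 + sys.P * sys.gain s k) ≤
        (1 - sys.m) * sys.F * sys.σmax) →
      sys.ΛccRevocable \ frontier sys.Γcc = interior sys.Γcc) ∧
    (∀ u : (Fin K → ℝ≥0) → ℝ, Continuous u →
      ∃ v : ℝ,
        IsLUB (u '' sys.Λcc) v ∧
        IsLUB (u '' sys.stabilityRegion) v ∧
        {r ∈ closure sys.Λcc | u r = v} = {r ∈ closure sys.stabilityRegion | u r = v} ∧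
        {r ∈ closure sys.Λcc | u r = v}.Nonempty) := by
  refine ⟨diff_frontier_eq_interior sys.interior_Γcc_subset_Λcc sys.Λcc_subset_Γcc,
    diff_frontier_eq_interior sys.interior_Γcc_subset_stabilityRegion
      sys.stabilityRegion_subset_Γcc,
    fun hcap => diff_frontier_eq_interior
      (sys.interior_Γcc_subset_Λcc.trans sys.Λcc_subset_ΛccRevocable)
      (sys.ΛccRevocable_subset_Γcc hcap),
    fun u hu => ?_⟩
  have hΛ : closure sys.Λcc = sys.Γcc := closure_eq_of_interior_subset sys.isClosed_Γcc
    sys.closure_interior_Γcc sys.interior_Γcc_subset_Λcc sys.Λcc_subset_Γcc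
  have hstable : closure sys.stabilityRegion = sys.Γcc :=
    closure_eq_of_interior_subset sys.isClosed_Γcc sys.closure_interior_Γcc
      sys.interior_Γcc_subset_stabilityRegion sys.stabilityRegion_subset_Γcc
  obtain ⟨δ, -, hδ⟩ := sys.exists_const_mem_Γcc
  obtain ⟨r, hr, hmax⟩ := sys.isCompact_Γcc.exists_isMaxOn ⟨_, hδ⟩ hu.continuousOn
  exact ⟨u r, isLUB_image_of_closure_eq hΛ hu hr hmax,
    isLUB_image_of_closure_eq hstable hu hr hmax, by rw [hΛ, hstable], r, hΛ.symm ▸ hr, rfl⟩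

end

theorem lemma1 {K : ℕ} (sys : CachingSystem K) :
    -- off the boundary of `Γ^CC`, the delivery region and the stability region are `Int Γ^CC`
    sys.Λcc \ frontier sys.Γcc = interior sys.Γcc ∧
    sys.stabilityRegion \ frontier sys.Γcc = interior sys.Γcc ∧
    -- if `σmax` files per slot exceed what any single user can receive uncoded on average,
    -- irrevocability of the combinations need not be imposed
    ((∀ k, sys.Tslot * ∑ s, sys.φ s * Real.logb 2 (1 + sys.P * sys.gain s k) ≤
        (1 - sys.m) * sys.F * sys.σmax) →
      sys.ΛccRevocable \ frontier sys.Γcc = interior sys.Γcc) ∧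
    -- the two optimization problems have the same value and the same limiting optimal rates
    (∀ α d : Fin K → ℝ, (∀ k, 0 ≤ α k) → (∀ k, 0 < d k) →
      ∃ v : ℝ,
        IsLUB (totalUtility α d '' sys.Λcc) v ∧
        IsLUB (totalUtility α d '' sys.stabilityRegion) v ∧
        {r ∈ closure sys.Λcc | totalUtility α d r = v} =
          {r ∈ closure sys.stabilityRegion | totalUtility α d r = v} ∧
        {r ∈ closure sys.Λcc | totalUtility α d r = v}.Nonempty) := by
  obtain ⟨hΛ, hstable, hrevocable, hutility⟩ := lemma1_general sys
  exact ⟨hΛ, hstable, hrevocable, fun α d _ hd => hutility _ (continuous_totalUtility hd)⟩
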